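/- Let $A\in\mathbb R^{n\times n}$, $B\in\mathbb R^{n\times m}$, $\Xi\in\mathbb R^{n\times k}$, let $Q,Q_f\in\mathbb R^{n\times n}$ be symmetric positive semidefinite and $R\in\mathbb R^{m\times m}$ symmetric positive definite, let $T\ge 1$, $N\ge 1$ and $\theta\in\mathbb R$, and for each stage $t$ let $\hat w_t^{(1)},\dots,\hat w_t^{(N)}\in\mathbb R^k$ be given, with empirical distribution $\nu_t=\frac1N\sum_i\delta_{\hat w_t^{(i)}}$, $\bar w_t=\frac1N\sum_i \hat w_t^{(i)}$ and $\Sigma_t=\frac1N\sum_i \hat w_t^{(i)}(\hat w_t^{(i)})^\top$. Consider $x_{t+1}=Ax_t+Bu_t+\Xi w_t$, $x_0=x$. A control policy $\pi\in\Pi$ is a sequence of measurable maps $u_t=\pi_t(x_t)$; an opponent policy $\gamma\in\Gamma$ is a sequence of stochastic kernels, $w_t$ being drawn from the probability measure $\mu_t=\gamma_t(x_t)$ on $\mathbb R^k$. For $\lambda\ge0$ let $$J_x^\lambda(\pi,\gamma)=\frac1T\,\mathbb E^{\pi,\gamma}\Big[x_T^\top Q_fx_T+\sum_{t=0}^{T-1}\big(x_t^\top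 Qx_t+u_t^\top Ru_t-\lambda W_2(\mu_t,\nu_t)^2\big)\Big],\qquad V(x;\lambda)=\inf_{\pi\in\Pi}\sup_{\gamma\in\Gamma}J^\lambda_x(\pi,\gamma),$$ where $W_2\in[0,\infty]$ is the Wasserstein distance of order $2$ for the Euclidean norm and $J^\lambda_x(\pi,\gamma):=-\infty$ if the expected penalty $\mathbb E^{\pi,\gamma}[\sum_t\lambda W_2(\mu_t,\nu_t)^2]$ is infinite (for $\lambda=0$ there is no penalty). Let $\Phi^\lambda=BR^{-1}B^\top-\frac1\lambda\Xi\Xi^\top$, and let $P_t^\lambda,r_t^\lambda,z_t^\lambda$ be given by $P_T^\lambda=Q_f$, $r_T^\lambda=0$, $z_T^\lambda=0$ and, for $t=T-1,\dots,0$ (with $P=P_{t+1}^\lambda$, $r=r_{t+1}^\lambda$, $\Phi=\Phi^\lambda$), $$\begin{aligned}P_t^\lambda&=Q+A^\top(I+P\Phi)^{-1}PA,\qquad r_t^\lambda=A^\top(I+P\Phi)^{-1}(P\Xi\bar w_t+r),\\ z_t^\lambda&=z_{t+1}^\lambda+\mathrm{tr}\big[(I-\Xi^\top P\Xi/\lambda)^{-1}\Xi^\top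 P\Xi\,\Sigma_t\big]+\bar w_t^\top\Xi^\top\big[(I+P\Phi)^{-1}-(I-P\Xi\Xi^\top/\lambda)^{-1}\big]P\Xi\bar w_t\\&\quad+(2\bar w_t^\top\Xi^\top-r^\top\Phi)(I+P\Phi)^{-1}r.\end{aligned}$$ Let $\hat\lambda=\inf\{\lambda\ge0:\ \lambda I-\Xi^\top P_t^\lambda\Xi\succ0,\ t=1,\dots,T\}$. Then: (i) For every $\lambda>\hat\lambda$ one has $\lambda I-\Xi^\top P_t^\lambda\Xi\succ0$ for $t=1,\dots,T$, and all the inverses in the recursion exist. (ii) For every $x\in\mathbb R^n$, $V(x;\lambda)=+\infty$ if $0\le\lambda<\hat\lambda$, and $V(x;\lambda)=\frac1T\big(x^\top P_0^\lambda x+2(r_0^\lambda)^\top x+z_0^\lambda\big)<\infty$ if $\lambda>\hat\lambda$. (iii) For every $x\in\mathbb R^n$, if $\lambda_*$ minimizes $\lambda\theta^2+\frac1T\big(x^\top P_0^\lambda x+2(r_0^\lambda)^\top x+z_0^\lambda\big)$ over $\lambda>\hat\lambda$, then $\lambda_*$ minimizes $\lambda\theta^2+V(x;\lambda)$ over all $\lambda\ge0$.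 (iv) The reduced problem in (iii) is convex: for every $x$ its objective is a convex function of $\lambda\in(\hat\lambda,\infty)$. Moreover $V$ is jointly convex in $(\lambda,x)$ on $(\hat\lambda,\infty)\times\mathbb R^n$. -/

import Mathlib

open MeasureTheory ProbabilityTheory Set
open scoped ENNReal Matrix

noncomputable section

namespace WassersteinLQ

/-- Data of the finite-horizon problem: system matrices, cost matrices, horizon and, for every
stage `t`, the sample `what t 0, …, what t (N-1)` of the disturbance `w_t`. -/
structure Data (n m k N : ℕ) where
  A : Matrix (Fin n) (Fin n) ℝ
  B : Matrix (Fin n) (Fin m) ℝ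
  Xi : Matrix (Fin n) (Fin k) ℝ
  Q : Matrix (Fin n) (Fin n) ℝ
  Qf : Matrix (Fin n) (Fin n) ℝ
  R : Matrix (Fin m) (Fin m) ℝ
  T : ℕ
  what : ℕ → Fin N → (Fin k → ℝ)

/-- The Wasserstein distance of order two on `ℝ^k` with the Euclidean norm, with values
in `[0, ∞]`. The infimum is over the couplings of the two measures. -/
def wasserstein2 {k : ℕ} (μ ν : Measure (Fin k → ℝ)) : ℝ≥0∞ :=
  ⨅ η ∈ {η : Measure ((Fin k → ℝ) × (Fin k → ℝ)) | η.fst = μ ∧ η.snd = ν},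
    (∫⁻ p, ‖WithLp.toLp 2 (p.1 - p.2)‖ₑ ^ 2 ∂η) ^ (1 / 2 : ℝ)

/-- Admissible control policies: sequences of measurable maps from states to inputs. -/
def ControlPolicy (n m : ℕ) : Type :=
  {π : ℕ → (Fin n → ℝ) → (Fin m → ℝ) // ∀ t, Measurable (π t)}

/-- Admissible opponent policies: sequences of stochastic kernels from states to disturbances. -/
def OpponentPolicy (n k : ℕ) : Type :=
  {γ : ℕ → Kernel (Fin n → ℝ) (Fin k → ℝ) // ∀ t, IsMarkovKernel (γ t)}

namespace Data

variable {n m k N : ℕ} (D : Data n m k N)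

/-- The empirical distribution `ν_t` of the sample at stage `t`. -/
def empirical (t : ℕ) : Measure (Fin k → ℝ) :=
  (N : ℝ≥0∞)⁻¹ • ∑ i, Measure.dirac (D.what t i)

/-- The law of the trajectory up to time `t`, started at `x` and driven by the two policies, as a
measure on sequences of states (coordinates after time `t` are not yet simulated). In the step
from `t` to `t + 1` the disturbance `w` is drawn from `γ_t (x_t)` and the coordinate `t + 1` is set
to `A x_t + B π_t (x_t) + Ξ w`. -/
def pathLaw (π : ControlPolicy n m) (γ : OpponentPolicy n k) (x : Fin n → ℝ) :
    ℕ → Measure (ℕ → Fin n → ℝ)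
  | 0 => Measure.dirac (fun _ => x)
  | t + 1 =>
      (pathLaw π γ x t ⊗ₘ (γ.1 t).comap (fun ω => ω t) (measurable_pi_apply t)).map
        (fun p => Function.update p.1 (t + 1)
          (D.A *ᵥ p.1 t + D.B *ᵥ π.1 t (p.1 t) + D.Xi *ᵥ p.2))

/-- The quadratic cost `x_Tᵀ Q_f x_T + ∑_{t<T} (x_tᵀ Q x_t + u_tᵀ R u_t)` along a state path. -/
def pathCost (π : ControlPolicy n m) (ω : ℕ → Fin n → ℝ) : ℝ :=
  ω D.T ⬝ᵥ D.Qf *ᵥ ω D.T +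
    ∑ t ∈ Finset.range D.T,
      (ω t ⬝ᵥ D.Q *ᵥ ω t + π.1 t (ω t) ⬝ᵥ D.R *ᵥ π.1 t (ω t))

/-- The expected quadratic cost over the horizon (the cost is nonnegative when `Q`, `Q_f`, `R` are
positive semidefinite). -/
def expectedCost (π : ControlPolicy n m) (γ : OpponentPolicy n k) (x : Fin n → ℝ) : ℝ≥0∞ :=
  ∫⁻ ω, ENNReal.ofReal (D.pathCost π ω) ∂(D.pathLaw π γ x D.T)

/-- The expected total squared Wasserstein deviation `∑_{t<T} W₂(γ_t(x_t), ν_t)²`. -/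
def expectedDeviation (π : ControlPolicy n m) (γ : OpponentPolicy n k) (x : Fin n → ℝ) : ℝ≥0∞ :=
  ∫⁻ ω, ∑ t ∈ Finset.range D.T, wasserstein2 (γ.1 t (ω t)) (D.empirical t) ^ 2
    ∂(D.pathLaw π γ x D.T)

/-- The penalized cost `J^lam_x(π, γ)`. In `EReal`, `⊤ - ⊤ = ⊥`: an opponent policy of infinite
expected penalty gives the opponent the value `-∞`; for `lam = 0` there is no penalty. -/
def J (lam : ℝ) (π : ControlPolicy n m) (γ : OpponentPolicy n k) (x : Fin n → ℝ) : EReal :=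
  ((D.expectedCost π γ x : EReal)
    - ((ENNReal.ofReal lam * D.expectedDeviation π γ x : ℝ≥0∞) : EReal)) / ((D.T : ℝ) : EReal)

/-- The optimal value `V(x; lam) = inf_π sup_γ J^lam_x(π, γ)`. -/
def V (x : Fin n → ℝ) (lam : ℝ) : EReal :=
  ⨅ π : ControlPolicy n m, ⨆ γ : OpponentPolicy n k, D.J lam π γ x

/-- The sample mean at stage `t`. -/
def wbar (t : ℕ) : Fin k → ℝ := (N : ℝ)⁻¹ • ∑ i, D.what t i

/-- The sample second-moment matrix at stage `t`. -/
def Sig (t : ℕ) : Matrix (Fin k) (Fin k) ℝ :=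
  (N : ℝ)⁻¹ • ∑ i, Matrix.vecMulVec (D.what t i) (D.what t i)

/-- `Φ = B R⁻¹ Bᵀ - Ξ Ξᵀ / lam`. -/
def Phi (lam : ℝ) : Matrix (Fin n) (Fin n) ℝ :=
  D.B * D.R⁻¹ * D.Bᵀ - (1 / lam) • (D.Xi * D.Xiᵀ)

/-- One backward step of the Riccati recursion, from `(P_{t+1}, r_{t+1}, z_{t+1})` to
`(P_t, r_t, z_t)`. -/
def riccatiStep (lam : ℝ) (t : ℕ) (S : Matrix (Fin n) (Fin n) ℝ × (Fin n → ℝ) × ℝ) :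
    Matrix (Fin n) (Fin n) ℝ × (Fin n → ℝ) × ℝ :=
  let P := S.1
  let r := S.2.1
  let z := S.2.2
  let M := (1 + P * D.Phi lam)⁻¹
  let G := D.Xiᵀ * P * D.Xi
  let b := D.Xi *ᵥ D.wbar t
  (D.Q + D.Aᵀ * M * P * D.A,
   (D.Aᵀ * M) *ᵥ (P *ᵥ b + r),
   z + ((1 - (1 / lam) • G)⁻¹ * G * D.Sig t).trace
     + b ⬝ᵥ ((M - (1 - (1 / lam) • (P * D.Xi * D.Xiᵀ))⁻¹) * P) *ᵥ b
     + ((2 : ℝ) • b - r ᵥ* D.Phi lam) ⬝ᵥ M *ᵥ r)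

/-- The triple `(P_{T-s}, r_{T-s}, z_{T-s})`, indexed by the number `s ≤ T` of stages to go. -/
def riccatiToGo (lam : ℝ) : ℕ → Matrix (Fin n) (Fin n) ℝ × (Fin n → ℝ) × ℝ
  | 0 => (D.Qf, 0, 0)
  | s + 1 => D.riccatiStep lam (D.T - (s + 1)) (riccatiToGo lam s)

/-- `P_t^lam`, for `t ≤ T`. -/
def P (lam : ℝ) (t : ℕ) : Matrix (Fin n) (Fin n) ℝ := (D.riccatiToGo lam (D.T - t)).1

/-- `r_t^lam`, for `t ≤ T`. -/
def r (lam : ℝ) (t : ℕ) : Fin n → ℝ := (D.riccatiToGo lam (D.T - t)).2.1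

/-- `z_t^lam`, for `t ≤ T`. -/
def z (lam : ℝ) (t : ℕ) : ℝ := (D.riccatiToGo lam (D.T - t)).2.2

/-- The condition `lam I - Ξᵀ P_t^lam Ξ ≻ 0` for `t = 1, …, T`. -/
def Admissible (lam : ℝ) : Prop :=
  ∀ t ∈ Finset.Icc 1 D.T, (lam • (1 : Matrix (Fin k) (Fin k) ℝ) - D.Xiᵀ * D.P lam t * D.Xi).PosDef

/-- All the matrices inverted in the Riccati recursion with parameter `lam` are invertible. -/
def RiccatiWellDefined (lam : ℝ) : Prop :=
  ∀ t ∈ Finset.Icc 1 D.T,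
    IsUnit (1 + D.P lam t * D.Phi lam) ∧
    IsUnit (1 - (1 / lam) • (D.Xiᵀ * D.P lam t * D.Xi)) ∧
    IsUnit (1 - (1 / lam) • (D.P lam t * D.Xi * D.Xiᵀ))

/-- The threshold `λ̂`. -/
def lamHat : ℝ := sInf {lam : ℝ | 0 ≤ lam ∧ D.Admissible lam}

/-- `(xᵀ P_0^lam x + 2 (r_0^lam)ᵀ x + z_0^lam) / T`. -/
def riccatiValue (x : Fin n → ℝ) (lam : ℝ) : ℝ :=
  (x ⬝ᵥ D.P lam 0 *ᵥ x + 2 * (D.r lam 0 ⬝ᵥ x) + D.z lam 0) / D.T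

end Data

end WassersteinLQ

end

/-! The proof is dynamic programming for a zero-sum game whose stage problem has an explicit saddle
point. Suppose the cost-to-go is `yᵀPy + 2rᵀy + z` with `P` positive semidefinite. The stage payoff
is convex in the control, and `lam I - ΞᵀPΞ ≻ 0` makes it strictly concave in the displacement of
each sample point. Weak Wasserstein duality (`lintegral_le_add_wasserstein2_sq`) bounds the
opponent's choice of a measure by separate choices of one displacement for each atom. The
stationarity conditions are solved by a costate `p` with `(I + PΦ)p = P(Ax + Ξw̄) + r`: the control
is `-R⁻¹Bᵀp`, and the atoms move by `Ξᵀp / lam` plus a term linear in the centred sample. The value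
is the Riccati step (`saddle_value`). The saddle control gives the upper bound for `V` (`J_le`) and
the saddle shift the lower one (`le_J_shiftPolicy`).

For the threshold, let the penalty condition for `lam'` fail, and take the last stage where it does.
There a direction `w` has growth at least `lam' |w|²`. If `lam < lam'`, a large shift along `w`,
followed by the saddle shifts for `lam'`, makes the cost of every control policy arbitrarily large.
Hence a finite value at `lam` makes every `lam' > lam` admissible (`admissible_of_V_ne_top`).
Positive admissible parameters have finite value, so admissibility passes to larger parameters and
the value is infinite below `λ̂`.

Joint convexity follows by backward induction from the two saddle inequalities, since the penalty is
linear in `lam` and the dynamics are linear. -/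

noncomputable section

namespace WassersteinLQ

variable {n m k N : ℕ}

namespace Data

variable (D : Data n m k N)

/-! ### Expectations along the controlled process and verification inequalities. -/

/-- The successor state. -/
def next (x : Fin n → ℝ) (u : Fin m → ℝ) (w : Fin k → ℝ) : Fin n → ℝ :=
  D.A *ᵥ x + D.B *ᵥ u + D.Xi *ᵥ w

/-- The stage cost. -/
def stageCost (x : Fin n → ℝ) (u : Fin m → ℝ) : ℝ := x ⬝ᵥ D.Q *ᵥ x + u ⬝ᵥ D.R *ᵥ u

lemma continuous_next :
    Continuous fun p : (Fin n → ℝ) × (Fin m → ℝ) × (Fin k → ℝ) => D.next p.1 p.2.1 p.2.2 := by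
  unfold next
  fun_prop

lemma continuous_stageCost :
    Continuous fun p : (Fin n → ℝ) × (Fin m → ℝ) => D.stageCost p.1 p.2 := by
  unfold stageCost
  fun_prop

lemma measurable_stageCost (π : ControlPolicy n m) (t : ℕ) :
    Measurable fun x => ENNReal.ofReal (D.stageCost x (π.1 t x)) :=
  (D.continuous_stageCost.measurable.comp (measurable_id.prodMk (π.2 t))).ennreal_ofReal

lemma measurable_next (π : ControlPolicy n m) (t : ℕ) :
    Measurable fun p : (Fin n → ℝ) × (Fin k → ℝ) => D.next p.1 (π.1 t p.1) p.2 :=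
  D.continuous_next.measurable.comp
    (measurable_fst.prodMk (((π.2 t).comp measurable_fst).prodMk measurable_snd))

lemma measurable_pathStep (π : ControlPolicy n m) (t : ℕ) :
    Measurable fun p : (ℕ → Fin n → ℝ) × (Fin k → ℝ) => Function.update p.1 (t + 1)
      (D.A *ᵥ p.1 t + D.B *ᵥ π.1 t (p.1 t) + D.Xi *ᵥ p.2) := by
  refine measurable_pi_lambda _ fun s => ?_
  by_cases hs : s = t + 1
  · subst hs
    simp only [Function.update_self]
    exact (D.measurable_next π t).comp (g := fun p : (Fin n → ℝ) × (Fin k → ℝ) =>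
      D.next p.1 (π.1 t p.1) p.2) (f := fun p : (ℕ → Fin n → ℝ) × (Fin k → ℝ) => (p.1 t, p.2))
      (((measurable_pi_apply t).comp measurable_fst).prodMk measurable_snd)
  · simp only [Function.update_of_ne hs]
    exact (measurable_pi_apply s).comp measurable_fst

lemma isProbabilityMeasure_pathLaw (π : ControlPolicy n m) (γ : OpponentPolicy n k)
    (x : Fin n → ℝ) (t : ℕ) : IsProbabilityMeasure (D.pathLaw π γ x t) := by
  induction t with
  | zero => unfold pathLaw; infer_instance
  | succ t ih =>
    have := γ.2 t
    unfold pathLaw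
    exact Measure.isProbabilityMeasure_map (D.measurable_pathStep π t).aemeasurable

lemma lintegral_pathLaw_succ (π : ControlPolicy n m) (γ : OpponentPolicy n k)
    (x : Fin n → ℝ) (t : ℕ) {F : (ℕ → Fin n → ℝ) → ℝ≥0∞} (hF : Measurable F) :
    ∫⁻ ω, F ω ∂D.pathLaw π γ x (t + 1) = ∫⁻ ω, ∫⁻ w, F (Function.update ω (t + 1)
      (D.next (ω t) (π.1 t (ω t)) w)) ∂γ.1 t (ω t) ∂D.pathLaw π γ x t := by
  have := γ.2 t
  have := D.isProbabilityMeasure_pathLaw π γ x t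
  have hs := D.measurable_pathStep π t
  rw [pathLaw]
  exact (lintegral_map hF hs).trans (Measure.lintegral_compProd (hF.comp hs))

/-- The expectation of a function of the state at time `t`. -/
def stateExp (π : ControlPolicy n m) (γ : OpponentPolicy n k) (x : Fin n → ℝ) (t : ℕ)
    (h : (Fin n → ℝ) → ℝ≥0∞) : ℝ≥0∞ := ∫⁻ ω, h (ω t) ∂D.pathLaw π γ x t

/-- The conditional expectation of `h (x_{t+1})` given `x_t = x`. -/
def stepExp (π : ControlPolicy n m) (γ : OpponentPolicy n k) (t : ℕ)
    (h : (Fin n → ℝ) → ℝ≥0∞) (x : Fin n → ℝ) : ℝ≥0∞ :=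
  ∫⁻ w, h (D.next x (π.1 t x) w) ∂γ.1 t x

lemma measurable_stepExp (π : ControlPolicy n m) (γ : OpponentPolicy n k) (t : ℕ)
    {h : (Fin n → ℝ) → ℝ≥0∞} (hh : Measurable h) : Measurable (D.stepExp π γ t h) := by
  have := γ.2 t
  exact Measurable.lintegral_kernel_prod_right' (κ := γ.1 t)
    (f := fun p : (Fin n → ℝ) × (Fin k → ℝ) => h (D.next p.1 (π.1 t p.1) p.2))
    (hh.comp (D.measurable_next π t))

lemma stateExp_zero (π : ControlPolicy n m) (γ : OpponentPolicy n k) (x : Fin n → ℝ)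
    {h : (Fin n → ℝ) → ℝ≥0∞} (hh : Measurable h) : D.stateExp π γ x 0 h = h x := by
  unfold stateExp pathLaw
  exact lintegral_dirac' _ (hh.comp (measurable_pi_apply 0))

lemma stateExp_succ (π : ControlPolicy n m) (γ : OpponentPolicy n k) (x : Fin n → ℝ) (t : ℕ)
    {h : (Fin n → ℝ) → ℝ≥0∞} (hh : Measurable h) :
    D.stateExp π γ x (t + 1) h = D.stateExp π γ x t (D.stepExp π γ t h) := by
  unfold stateExp
  refine (D.lintegral_pathLaw_succ π γ x t (F := fun ω => h (ω (t + 1)))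
    (hh.comp (measurable_pi_apply (t + 1)))).trans ?_
  simp [stepExp]

/-- Transitions after time `t` only overwrite later coordinates and are probability kernels. -/
lemma lintegral_pathLaw_eq_stateExp (π : ControlPolicy n m) (γ : OpponentPolicy n k)
    (x : Fin n → ℝ) {t s : ℕ} (hts : t ≤ s) {h : (Fin n → ℝ) → ℝ≥0∞} (hh : Measurable h) :
    ∫⁻ ω, h (ω t) ∂D.pathLaw π γ x s = D.stateExp π γ x t h := by
  induction s, hts using Nat.le_induction with
  | base => rfl
  | succ s hs ih =>
    refine (D.lintegral_pathLaw_succ π γ x s (F := fun ω => h (ω t))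
      (hh.comp (measurable_pi_apply t))).trans ?_
    rw [← ih]
    have : t ≠ s + 1 := by omega
    have hP := γ.2 s
    simp [Function.update_of_ne this]

lemma stateExp_mono (π : ControlPolicy n m) (γ : OpponentPolicy n k) (x : Fin n → ℝ) (t : ℕ)
    {h h' : (Fin n → ℝ) → ℝ≥0∞} (hh : ∀ y, h y ≤ h' y) :
    D.stateExp π γ x t h ≤ D.stateExp π γ x t h' :=
  lintegral_mono fun _ => hh _

lemma stateExp_add (π : ControlPolicy n m) (γ : OpponentPolicy n k) (x : Fin n → ℝ) (t : ℕ)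
    {h h' : (Fin n → ℝ) → ℝ≥0∞} (hh : Measurable h) :
    D.stateExp π γ x t (fun y => h y + h' y) = D.stateExp π γ x t h + D.stateExp π γ x t h' :=
  lintegral_add_left (hh.comp (measurable_pi_apply t)) _

lemma stateExp_const_mul (π : ControlPolicy n m) (γ : OpponentPolicy n k) (x : Fin n → ℝ) (t : ℕ)
    {h : (Fin n → ℝ) → ℝ≥0∞} (hh : Measurable h) (c : ℝ≥0∞) :
    D.stateExp π γ x t (fun y => c * h y) = c * D.stateExp π γ x t h :=
  lintegral_const_mul _ (hh.comp (measurable_pi_apply t))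

lemma lintegral_sum_pathLaw (π : ControlPolicy n m) (γ : OpponentPolicy n k) (x : Fin n → ℝ)
    {g : ℕ → (Fin n → ℝ) → ℝ≥0∞} (hg : ∀ t, Measurable (g t)) :
    ∫⁻ ω, ∑ t ∈ Finset.range D.T, g t (ω t) ∂D.pathLaw π γ x D.T =
      ∑ t ∈ Finset.range D.T, D.stateExp π γ x t (g t) := by
  refine (lintegral_finsetSum _ fun t _ => (hg t).comp (measurable_pi_apply t)).trans ?_
  exact Finset.sum_congr rfl fun t ht =>
    D.lintegral_pathLaw_eq_stateExp π γ x (Finset.mem_range.1 ht).le (hg t)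

lemma stageCost_nonneg (hQ : D.Q.PosSemidef) (hR : D.R.PosDef) (x : Fin n → ℝ) (u : Fin m → ℝ) :
    0 ≤ D.stageCost x u := by
  have h1 := hQ.dotProduct_mulVec_nonneg x
  have h2 := hR.posSemidef.dotProduct_mulVec_nonneg u
  simp only [star_trivial] at h1 h2
  exact add_nonneg h1 h2

lemma expectedCost_eq (hQ : D.Q.PosSemidef) (hQf : D.Qf.PosSemidef) (hR : D.R.PosDef)
    (π : ControlPolicy n m) (γ : OpponentPolicy n k) (x : Fin n → ℝ) :
    D.expectedCost π γ x = D.stateExp π γ x D.T (fun y => ENNReal.ofReal (y ⬝ᵥ D.Qf *ᵥ y)) +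
      ∑ t ∈ Finset.range D.T,
        D.stateExp π γ x t (fun y => ENNReal.ofReal (D.stageCost y (π.1 t y))) := by
  have hf : Measurable fun y : Fin n → ℝ => ENNReal.ofReal (y ⬝ᵥ D.Qf *ᵥ y) :=
    (Continuous.measurable (by fun_prop)).ennreal_ofReal
  rw [← D.lintegral_sum_pathLaw π γ x (D.measurable_stageCost π), stateExp]
  refine Eq.trans (lintegral_congr fun ω => ?_)
    (lintegral_add_left (hf.comp (measurable_pi_apply D.T)) _)
  have h1 := hQf.dotProduct_mulVec_nonneg (ω D.T)
  simp only [star_trivial] at h1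
  rw [← ENNReal.ofReal_sum_of_nonneg fun t _ => D.stageCost_nonneg hQ hR _ _,
    Function.comp_apply,
    ← ENNReal.ofReal_add h1 (Finset.sum_nonneg fun t _ => D.stageCost_nonneg hQ hR _ _)]
  rfl

/-- Telescoping by addition alone: the intermediate expectation `c` may be `⊤`, so it cannot be
cancelled. -/
lemma add_step_le {a b c d e f s : ℝ≥0∞} (h1 : a + b ≤ c + d) (h2 : c + s ≤ e + f) :
    b + s + a ≤ e + f + d := by
  calc b + s + a = a + b + s := by ring
    _ ≤ c + d + s := by gcongr
    _ = c + s + d := by ring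
    _ ≤ e + f + d := by gcongr

lemma le_add_step {a b c d e f s : ℝ≥0∞} (h1 : c + d ≤ a + b) (h2 : e + f ≤ c + s) :
    e + f + d ≤ b + s + a := by
  calc e + f + d ≤ c + s + d := by gcongr
    _ = c + d + s := by ring
    _ ≤ a + b + s := by gcongr
    _ = b + s + a := by ring

/-- Verification: superharmonic functions bound the expected cost from above. -/
lemma expectedCost_le_of_step_le (hQ : D.Q.PosSemidef) (hQf : D.Qf.PosSemidef) (hR : D.R.PosDef)
    (π : ControlPolicy n m) (γ : OpponentPolicy n k) (x : Fin n → ℝ) {lam : ℝ≥0∞}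
    {F g : ℕ → (Fin n → ℝ) → ℝ≥0∞} (hF : ∀ t, Measurable (F t)) (hg : ∀ t, Measurable (g t))
    (hT : ∀ y, ENNReal.ofReal (y ⬝ᵥ D.Qf *ᵥ y) ≤ F D.T y)
    (hstep : ∀ t < D.T, ∀ y, ENNReal.ofReal (D.stageCost y (π.1 t y)) +
      D.stepExp π γ t (F (t + 1)) y ≤ F t y + lam * g t y) :
    D.expectedCost π γ x ≤
      F 0 x + lam * ∑ t ∈ Finset.range D.T, D.stateExp π γ x t (g t) := by
  have key : ∀ t ≤ D.T, D.stateExp π γ x t (F t) + ∑ s ∈ Finset.range t,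
      D.stateExp π γ x s (fun y => ENNReal.ofReal (D.stageCost y (π.1 s y))) ≤
      F 0 x + lam * ∑ s ∈ Finset.range t, D.stateExp π γ x s (g s) := by
    intro t ht
    induction t with
    | zero => simp [D.stateExp_zero π γ x (hF 0)]
    | succ t ih =>
      have h1 := D.stateExp_mono π γ x t (hstep t (by omega))
      rw [D.stateExp_add π γ x t (D.measurable_stageCost π t), D.stateExp_add π γ x t (hF t),
        D.stateExp_const_mul π γ x t (hg t), ← D.stateExp_succ π γ x t (hF (t + 1))] at h1
      rw [Finset.sum_range_succ, Finset.sum_range_succ, mul_add, ← add_assoc, ← add_assoc]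
      exact add_step_le h1 (ih (by omega))
  rw [D.expectedCost_eq hQ hQf hR]
  exact (add_le_add_left (D.stateExp_mono π γ x D.T hT) _).trans (key D.T le_rfl)

/-- Verification: subharmonic functions bound the expected cost from below. -/
lemma le_expectedCost_of_le_step (hQ : D.Q.PosSemidef) (hQf : D.Qf.PosSemidef) (hR : D.R.PosDef)
    (π : ControlPolicy n m) (γ : OpponentPolicy n k) (x : Fin n → ℝ) {lam : ℝ≥0∞}
    {F g : ℕ → (Fin n → ℝ) → ℝ≥0∞} (hF : ∀ t, Measurable (F t)) (hg : ∀ t, Measurable (g t))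
    (hT : ∀ y, F D.T y ≤ ENNReal.ofReal (y ⬝ᵥ D.Qf *ᵥ y))
    (hstep : ∀ t < D.T, ∀ y, F t y + lam * g t y ≤
      ENNReal.ofReal (D.stageCost y (π.1 t y)) + D.stepExp π γ t (F (t + 1)) y) :
    F 0 x + lam * ∑ t ∈ Finset.range D.T, D.stateExp π γ x t (g t) ≤
      D.expectedCost π γ x := by
  have key : ∀ t ≤ D.T, F 0 x + lam * ∑ s ∈ Finset.range t, D.stateExp π γ x s (g s) ≤
      D.stateExp π γ x t (F t) + ∑ s ∈ Finset.range t,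
      D.stateExp π γ x s (fun y => ENNReal.ofReal (D.stageCost y (π.1 s y))) := by
    intro t ht
    induction t with
    | zero => simp [D.stateExp_zero π γ x (hF 0)]
    | succ t ih =>
      have h1 := D.stateExp_mono π γ x t (hstep t (by omega))
      rw [D.stateExp_add π γ x t (D.measurable_stageCost π t), D.stateExp_add π γ x t (hF t),
        D.stateExp_const_mul π γ x t (hg t), ← D.stateExp_succ π γ x t (hF (t + 1))] at h1
      rw [Finset.sum_range_succ, Finset.sum_range_succ, mul_add, ← add_assoc, ← add_assoc]
      exact le_add_step h1 (ih (by omega))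
  rw [D.expectedCost_eq hQ hQf hR]
  exact (key D.T le_rfl).trans (add_le_add_left (D.stateExp_mono π γ x D.T hT) _)

end Data

/-! ### Uniform measures on finite samples and Wasserstein duality. -/

/-- The arithmetic mean of a finite family of reals. -/
def avg (a : Fin N → ℝ) : ℝ := (N : ℝ)⁻¹ * ∑ i, a i

lemma avg_add (a b : Fin N → ℝ) : avg (fun i => a i + b i) = avg a + avg b := by
  simp [avg, Finset.sum_add_distrib, mul_add]

lemma avg_const_mul (c : ℝ) (a : Fin N → ℝ) : avg (fun i => c * a i) = c * avg a := by
  simp only [avg, ← Finset.mul_sum]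
  ring

lemma avg_sub (a b : Fin N → ℝ) : avg (fun i => a i - b i) = avg a - avg b := by
  simp [avg, Finset.sum_sub_distrib, mul_sub]

lemma avg_const (hN : 0 < N) (c : ℝ) : avg (fun _ : Fin N => c) = c := by
  have : (N : ℝ) ≠ 0 := by positivity
  simp [avg, this]

lemma avg_mono {a b : Fin N → ℝ} (h : ∀ i, a i ≤ b i) : avg a ≤ avg b :=
  mul_le_mul_of_nonneg_left (Finset.sum_le_sum fun i _ => h i) (by positivity)

lemma avg_nonneg {a : Fin N → ℝ} (h : ∀ i, 0 ≤ a i) : 0 ≤ avg a :=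
  mul_nonneg (by positivity) (Finset.sum_nonneg fun i _ => h i)

lemma ofReal_avg (hN : 0 < N) {a : Fin N → ℝ} (h : ∀ i, 0 ≤ a i) :
    ENNReal.ofReal (avg a) = (N : ℝ≥0∞)⁻¹ * ∑ i, ENNReal.ofReal (a i) := by
  have hN' : (0 : ℝ) < N := by exact_mod_cast hN
  rw [avg, ENNReal.ofReal_mul (by positivity), ENNReal.ofReal_inv_of_pos hN',
    ENNReal.ofReal_natCast, ENNReal.ofReal_sum_of_nonneg fun i _ => h i]

/-- The uniform distribution on a finite family of points. -/
def uniformMeasure {α : Type*} [MeasurableSpace α] (a : Fin N → α) : Measure α :=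
  (N : ℝ≥0∞)⁻¹ • ∑ i, Measure.dirac (a i)

lemma lintegral_uniformMeasure {α : Type*} [MeasurableSpace α] (a : Fin N → α) {h : α → ℝ≥0∞}
    (hh : Measurable h) :
    ∫⁻ y, h y ∂uniformMeasure a = (N : ℝ≥0∞)⁻¹ * ∑ i, h (a i) := by
  simp [uniformMeasure, lintegral_smul_measure, lintegral_finsetSum_measure,
    lintegral_dirac' _ hh]

lemma isProbabilityMeasure_uniformMeasure {α : Type*} [MeasurableSpace α] (hN : 0 < N)
    (a : Fin N → α) : IsProbabilityMeasure (uniformMeasure a) := by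
  refine ⟨?_⟩
  have h := lintegral_uniformMeasure a (h := fun _ => 1) measurable_const
  have h0 : (N : ℝ≥0∞) ≠ 0 := by exact_mod_cast hN.ne'
  simpa [ENNReal.inv_mul_cancel h0 (ENNReal.natCast_ne_top N)] using h

lemma map_uniformMeasure {α β : Type*} [MeasurableSpace α] [MeasurableSpace β] (a : Fin N → α)
    {f : α → β} (hf : Measurable f) :
    (uniformMeasure a).map f = uniformMeasure fun i => f (a i) := by
  refine Measure.ext_of_lintegral _ fun h hh => ?_
  rw [lintegral_map hh hf, lintegral_uniformMeasure _ hh,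
    lintegral_uniformMeasure a (h := fun y => h (f y)) (hh.comp hf)]

lemma dotProduct_self_nonneg (v : Fin k → ℝ) : 0 ≤ v ⬝ᵥ v :=
  Finset.sum_nonneg fun i _ => mul_self_nonneg (v i)

lemma enorm_toLp_sq (v : Fin k → ℝ) :
    ‖WithLp.toLp 2 v‖ₑ ^ 2 = ENNReal.ofReal (v ⬝ᵥ v) := by
  rw [← ofReal_norm, ← ENNReal.ofReal_pow (norm_nonneg _), EuclideanSpace.norm_sq_eq]
  simp [dotProduct, sq]

lemma wasserstein2_sq_le {μ ν : Measure (Fin k → ℝ)}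
    {η : Measure ((Fin k → ℝ) × (Fin k → ℝ))} (h1 : η.fst = μ) (h2 : η.snd = ν) :
    wasserstein2 μ ν ^ 2 ≤ ∫⁻ p, ENNReal.ofReal ((p.1 - p.2) ⬝ᵥ (p.1 - p.2)) ∂η := by
  have h : wasserstein2 μ ν ≤ (∫⁻ p, ‖WithLp.toLp 2 (p.1 - p.2)‖ₑ ^ 2 ∂η) ^ (1 / 2 : ℝ) :=
    iInf₂_le η ⟨h1, h2⟩
  simp only [enorm_toLp_sq] at h
  calc wasserstein2 μ ν ^ 2 ≤ (_ ^ (1 / 2 : ℝ)) ^ 2 := pow_le_pow_left₀ (zero_le) h 2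
    _ = _ := by rw [← ENNReal.rpow_natCast, ← ENNReal.rpow_mul]; norm_num

lemma le_wasserstein2_sq {μ ν : Measure (Fin k → ℝ)} {c : ℝ≥0∞}
    (h : ∀ η : Measure ((Fin k → ℝ) × (Fin k → ℝ)), η.fst = μ → η.snd = ν →
      c ≤ ∫⁻ p, ENNReal.ofReal ((p.1 - p.2) ⬝ᵥ (p.1 - p.2)) ∂η) :
    c ≤ wasserstein2 μ ν ^ 2 := by
  have h' : c ^ (1 / 2 : ℝ) ≤ wasserstein2 μ ν := by
    refine le_iInf₂ fun η hη => ENNReal.rpow_le_rpow ?_ (by norm_num)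
    simpa only [enorm_toLp_sq] using h η hη.1 hη.2
  calc c = (c ^ (1 / 2 : ℝ)) ^ 2 := by rw [← ENNReal.rpow_natCast, ← ENNReal.rpow_mul]; norm_num
    _ ≤ _ := pow_le_pow_left₀ (zero_le) h' 2

/-- Shifting the atoms of a uniform measure costs at most the mean squared shift. -/
lemma wasserstein2_uniformMeasure_sq_le (hN : 0 < N) (a d : Fin N → Fin k → ℝ) :
    wasserstein2 (uniformMeasure fun i => a i + d i) (uniformMeasure a) ^ 2 ≤
      ENNReal.ofReal (avg fun i => d i ⬝ᵥ d i) := by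
  refine (wasserstein2_sq_le (η := uniformMeasure fun i => (a i + d i, a i))
    (map_uniformMeasure _ measurable_fst) (map_uniformMeasure _ measurable_snd)).trans ?_
  rw [lintegral_uniformMeasure _ (Continuous.measurable (by fun_prop)).ennreal_ofReal,
    ofReal_avg hN fun i => dotProduct_self_nonneg _]
  simp

/-- Weak duality for the Wasserstein distance to a uniform measure. -/
lemma lintegral_le_add_wasserstein2_sq {μ : Measure (Fin k → ℝ)} {a : Fin N → Fin k → ℝ}
    {φ : (Fin k → ℝ) → ℝ≥0∞} (hφ : Measurable φ) {lam : ℝ≥0∞} (hl : lam ≠ 0) (hl' : lam ≠ ⊤)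
    {h : Fin N → ℝ≥0∞}
    (hle : ∀ w i, φ w ≤ h i + lam * ENNReal.ofReal ((w - a i) ⬝ᵥ (w - a i))) :
    ∫⁻ w, φ w ∂μ ≤ (N : ℝ≥0∞)⁻¹ * ∑ i, h i + lam * wasserstein2 μ (uniformMeasure a) ^ 2 := by
  classical
  -- Isolate the Wasserstein term, bound it through an arbitrary coupling, then undo the
  -- rearrangement.
  rw [← tsub_le_iff_left, mul_comm lam, ← ENNReal.div_le_iff_le_mul (Or.inl hl) (Or.inl hl')]
  refine le_wasserstein2_sq fun η h1 h2 => ?_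
  rw [ENNReal.div_le_iff_le_mul (Or.inl hl) (Or.inl hl'), tsub_le_iff_left, mul_comm _ lam]
  -- Atoms may coincide, so the bound as a function of the second coordinate is the least `h i` over
  -- the atoms at that point. Off the atoms it is `⊤` and nothing is claimed.
  set H : (Fin k → ℝ) → ℝ≥0∞ := fun y => ⨅ i, if y = a i then h i else ⊤ with hH
  have hHm : Measurable H := Measurable.iInf fun i =>
    Measurable.ite (measurableSet_singleton (a i)) measurable_const measurable_const
  have hd : Measurable fun p : (Fin k → ℝ) × (Fin k → ℝ) =>
      ENNReal.ofReal ((p.1 - p.2) ⬝ᵥ (p.1 - p.2)) :=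
    (Continuous.measurable (by fun_prop)).ennreal_ofReal
  have hpt : ∀ p : (Fin k → ℝ) × (Fin k → ℝ),
      φ p.1 ≤ H p.2 + lam * ENNReal.ofReal ((p.1 - p.2) ⬝ᵥ (p.1 - p.2)) := by
    intro p
    rw [hH, ENNReal.iInf_add]
    refine le_iInf fun i => ?_
    split_ifs with hp
    · rw [hp]; exact hle _ i
    · simp
  calc ∫⁻ w, φ w ∂μ = ∫⁻ p, φ p.1 ∂η := by rw [← h1, Measure.fst, lintegral_map hφ measurable_fst]
    _ ≤ ∫⁻ p, (H p.2 + lam * ENNReal.ofReal ((p.1 - p.2) ⬝ᵥ (p.1 - p.2))) ∂η :=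
      lintegral_mono hpt
    _ = ∫⁻ y, H y ∂η.snd + lam * ∫⁻ p, ENNReal.ofReal ((p.1 - p.2) ⬝ᵥ (p.1 - p.2)) ∂η := by
      rw [lintegral_add_left (f := fun p : (Fin k → ℝ) × (Fin k → ℝ) => H p.2)
        (hHm.comp measurable_snd), lintegral_const_mul _ hd, Measure.snd,
        lintegral_map hHm measurable_snd]
    _ ≤ _ := by
      rw [h2, lintegral_uniformMeasure a hHm]
      gcongr with i
      exact (iInf_le _ i).trans (by simp)

/-! ### Bounds for the penalized cost from sub- and superharmonic functions. -/

namespace Data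

variable (D : Data n m k N)

/-- The opponent policy that shifts the atoms of the empirical distribution. -/
def shiftPolicy (hN : 0 < N) (d : ℕ → (Fin n → ℝ) → Fin N → Fin k → ℝ)
    (hd : ∀ t i, Measurable fun x => d t x i) : OpponentPolicy n k :=
  ⟨fun t => ⟨fun x => uniformMeasure fun i => D.what t i + d t x i, by
      refine Measure.measurable_of_measurable_coe _ fun s hs => ?_
      simp only [uniformMeasure, Measure.smul_apply, Measure.finsetSum_apply, smul_eq_mul]
      refine Measurable.const_mul (Finset.measurable_fun_sum _ fun i _ => ?_) _
      exact (Measure.measurable_coe hs).comp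
        (Measure.measurable_dirac.comp ((hd t i).const_add _))⟩,
    fun _ => ⟨fun _ => isProbabilityMeasure_uniformMeasure hN _⟩⟩

variable {D} in
lemma stepExp_shiftPolicy (hN : 0 < N) {d : ℕ → (Fin n → ℝ) → Fin N → Fin k → ℝ}
    (hd : ∀ t i, Measurable fun x => d t x i) (π : ControlPolicy n m) (t : ℕ)
    {h : (Fin n → ℝ) → ℝ≥0∞} (hh : Measurable h) (x : Fin n → ℝ) :
    D.stepExp π (D.shiftPolicy hN d hd) t h x =
      (N : ℝ≥0∞)⁻¹ * ∑ i, h (D.next x (π.1 t x) (D.what t i + d t x i)) :=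
  lintegral_uniformMeasure (h := fun w => h (D.next x (π.1 t x) w)) _
    (hh.comp ((D.measurable_next π t).comp measurable_prodMk_left))

/-- Each transition is a finite average, so pointwise finite functions keep finite expectations.
This makes the expected penalty of a shift policy finite and excludes `⊤ - ⊤ = ⊥` in `J`. -/
lemma stateExp_shiftPolicy_lt_top (hN : 0 < N) {d : ℕ → (Fin n → ℝ) → Fin N → Fin k → ℝ}
    (hd : ∀ t i, Measurable fun x => d t x i) (π : ControlPolicy n m) (x : Fin n → ℝ) (t : ℕ)
    {h : (Fin n → ℝ) → ℝ≥0∞} (hh : Measurable h) (hfin : ∀ y, h y < ⊤) :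
    D.stateExp π (D.shiftPolicy hN d hd) x t h < ⊤ := by
  induction t generalizing h with
  | zero => rw [D.stateExp_zero _ _ _ hh]; exact hfin x
  | succ t ih =>
    rw [D.stateExp_succ _ _ _ _ hh]
    refine ih (D.measurable_stepExp _ _ _ hh) fun y => ?_
    rw [stepExp_shiftPolicy hN hd π t hh]
    have h0 : (N : ℝ≥0∞) ≠ 0 := by exact_mod_cast hN.ne'
    exact ENNReal.mul_lt_top (by simpa using hN) (by simp [ENNReal.sum_lt_top, hfin])

/-- The value against a shift policy is at least any subharmonic function. -/
lemma le_J_shiftPolicy (hQ : D.Q.PosSemidef) (hQf : D.Qf.PosSemidef) (hR : D.R.PosDef)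
    (hN : 0 < N) {d : ℕ → (Fin n → ℝ) → Fin N → Fin k → ℝ}
    (hd : ∀ t i, Measurable fun x => d t x i) (π : ControlPolicy n m) (x : Fin n → ℝ)
    {lam : ℝ} {F : ℕ → (Fin n → ℝ) → ℝ≥0∞} (hF : ∀ t, Measurable (F t))
    (hFT : ∀ y, F D.T y ≤ ENNReal.ofReal (y ⬝ᵥ D.Qf *ᵥ y))
    (hstep : ∀ t < D.T, ∀ y,
      F t y + ENNReal.ofReal lam * ENNReal.ofReal (avg fun i => d t y i ⬝ᵥ d t y i) ≤
      ENNReal.ofReal (D.stageCost y (π.1 t y)) +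
        (N : ℝ≥0∞)⁻¹ * ∑ i, F (t + 1) (D.next y (π.1 t y) (D.what t i + d t y i))) :
    (F 0 x : EReal) / ((D.T : ℝ) : EReal) ≤ D.J lam π (D.shiftPolicy hN d hd) x := by
  set γ := D.shiftPolicy hN d hd
  set g : ℕ → (Fin n → ℝ) → ℝ≥0∞ := fun t y => ENNReal.ofReal (avg fun i => d t y i ⬝ᵥ d t y i)
  have hg : ∀ t, Measurable (g t) := fun t => by
    refine Measurable.ennreal_ofReal (Measurable.const_mul
      (Finset.measurable_fun_sum _ fun i _ => ?_) _)
    have : Continuous fun v : Fin k → ℝ => v ⬝ᵥ v := by fun_prop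
    exact this.measurable.comp (hd t i)
  have h1 := D.le_expectedCost_of_le_step hQ hQf hR π γ x (lam := ENNReal.ofReal lam) hF hg hFT
    (fun t ht y => by
      rw [stepExp_shiftPolicy hN hd π t (hF (t + 1))]; exact hstep t ht y)
  have h2 : D.expectedDeviation π γ x ≤
      ∑ t ∈ Finset.range D.T, D.stateExp π γ x t (g t) := by
    rw [← D.lintegral_sum_pathLaw π γ x hg]
    exact lintegral_mono fun ω => Finset.sum_le_sum fun t _ =>
      wasserstein2_uniformMeasure_sq_le hN (D.what t) (d t (ω t))
  have h3 : D.expectedDeviation π γ x < ⊤ := h2.trans_lt (by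
    simp only [ENNReal.sum_lt_top]
    exact fun t _ => D.stateExp_shiftPolicy_lt_top hN hd π x t (hg t) fun y =>
      ENNReal.ofReal_lt_top)
  have h4 : F 0 x + ENNReal.ofReal lam * D.expectedDeviation π γ x ≤ D.expectedCost π γ x :=
    le_trans (by gcongr) h1
  have h5 : ENNReal.ofReal lam * D.expectedDeviation π γ x ≠ ⊤ :=
    (ENNReal.mul_lt_top ENNReal.ofReal_lt_top h3).ne
  refine EReal.div_le_div_right_of_nonneg (by simp) ?_
  refine (EReal.le_sub_iff_add_le (Or.inr (by simp)) (Or.inl (EReal.coe_ennreal_eq_top_iff.not.2 h5))).2 ?_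
  exact_mod_cast h4

/-- The value of a control policy is at most any superharmonic function. -/
lemma J_le (hQ : D.Q.PosSemidef) (hQf : D.Qf.PosSemidef) (hR : D.R.PosDef)
    (π : ControlPolicy n m) (γ : OpponentPolicy n k) (x : Fin n → ℝ)
    {lam : ℝ} (hlam : 0 < lam) {F : ℕ → (Fin n → ℝ) → ℝ≥0∞} (hF : ∀ t, Measurable (F t))
    (hFT : ∀ y, ENNReal.ofReal (y ⬝ᵥ D.Qf *ᵥ y) ≤ F D.T y)
    (hstep : ∀ t < D.T, ∀ y, ∃ h : Fin N → ℝ≥0∞,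
      (∀ w i, F (t + 1) (D.next y (π.1 t y) w) ≤ h i + ENNReal.ofReal lam *
        ENNReal.ofReal ((w - D.what t i) ⬝ᵥ (w - D.what t i))) ∧
      ENNReal.ofReal (D.stageCost y (π.1 t y)) + (N : ℝ≥0∞)⁻¹ * ∑ i, h i ≤ F t y) :
    D.J lam π γ x ≤ (F 0 x : EReal) / ((D.T : ℝ) : EReal) := by
  have hl : ENNReal.ofReal lam ≠ 0 := by simpa using hlam
  set G : ℕ → (Fin n → ℝ) → ℝ≥0∞ := fun t y => ENNReal.ofReal (D.stageCost y (π.1 t y)) +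
      D.stepExp π γ t (F (t + 1)) y
  -- Measurability of the deviation `W₂²` in the state is never needed: its place is taken by the
  -- least `g` for which the step inequality holds. This `g` is measurable, and duality bounds it by
  -- the deviation.
  set g : ℕ → (Fin n → ℝ) → ℝ≥0∞ := fun t y => (G t y - F t y) / ENNReal.ofReal lam
  have hg : ∀ t, Measurable (g t) := fun t =>
    (((D.measurable_stageCost π t).add (D.measurable_stepExp π γ t (hF (t + 1)))).sub
      (hF t)).div_const _
  have hlg : ∀ t y, ENNReal.ofReal lam * g t y = G t y - F t y := fun t y =>
    ENNReal.mul_div_cancel hl ENNReal.ofReal_ne_top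
  have h1 := D.expectedCost_le_of_step_le hQ hQf hR π γ x (lam := ENNReal.ofReal lam) hF hg hFT
    (fun t ht y => by rw [hlg]; exact le_add_tsub)
  have hgW : ∀ t < D.T, ∀ y, g t y ≤ wasserstein2 (γ.1 t y) (D.empirical t) ^ 2 := by
    intro t ht y
    obtain ⟨h, hle, hsum⟩ := hstep t ht y
    rw [ENNReal.div_le_iff_le_mul (Or.inl hl) (Or.inl ENNReal.ofReal_ne_top), tsub_le_iff_left,
      mul_comm _ (ENNReal.ofReal lam)]
    have := lintegral_le_add_wasserstein2_sq (μ := γ.1 t y)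
      ((hF (t + 1)).comp ((D.measurable_next π t).comp (measurable_prodMk_left (x := y)))) hl
      ENNReal.ofReal_ne_top hle
    calc G t y ≤ ENNReal.ofReal (D.stageCost y (π.1 t y)) + _ := add_le_add_right this _
      _ ≤ _ := by rw [← add_assoc]; exact add_le_add_left hsum _
  have h2 : ∑ t ∈ Finset.range D.T, D.stateExp π γ x t (g t) ≤ D.expectedDeviation π γ x := by
    rw [← D.lintegral_sum_pathLaw π γ x hg]
    exact lintegral_mono fun ω => Finset.sum_le_sum fun t ht =>
      hgW t (Finset.mem_range.1 ht) (ω t)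
  have h4 : D.expectedCost π γ x ≤ F 0 x + ENNReal.ofReal lam * D.expectedDeviation π γ x :=
    h1.trans (by gcongr)
  refine EReal.div_le_div_right_of_nonneg (by simp) ?_
  refine EReal.sub_le_of_le_add ?_
  exact_mod_cast h4

end Data

/-! ### Quadratic functions, the penalty condition and invertibility. -/

/-- The quadratic function `xᵀ P x + 2 rᵀ x + z` of a triple `(P, r, z)`. -/
def quad (S : Matrix (Fin n) (Fin n) ℝ × (Fin n → ℝ) × ℝ) (x : Fin n → ℝ) : ℝ :=
  x ⬝ᵥ S.1 *ᵥ x + 2 * (S.2.1 ⬝ᵥ x) + S.2.2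

lemma continuous_quad (S : Matrix (Fin n) (Fin n) ℝ × (Fin n → ℝ) × ℝ) : Continuous (quad S) := by
  unfold quad
  fun_prop

lemma dotProduct_mulVec_comm_of_symm {P : Matrix (Fin n) (Fin n) ℝ} (hP : Pᵀ = P)
    (x y : Fin n → ℝ) : x ⬝ᵥ P *ᵥ y = y ⬝ᵥ P *ᵥ x := by
  rw [Matrix.dotProduct_mulVec, ← Matrix.mulVec_transpose, hP, dotProduct_comm]

lemma dotProduct_mulVec_transpose (X : Matrix (Fin n) (Fin k) ℝ) (x : Fin n → ℝ)
    (w : Fin k → ℝ) : x ⬝ᵥ X *ᵥ w = (Xᵀ *ᵥ x) ⬝ᵥ w := by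
  rw [Matrix.dotProduct_mulVec, Matrix.mulVec_transpose]

lemma quad_add {S : Matrix (Fin n) (Fin n) ℝ × (Fin n → ℝ) × ℝ} (hS : S.1ᵀ = S.1)
    (x y : Fin n → ℝ) :
    quad S (x + y) = quad S x + 2 * ((S.1 *ᵥ x + S.2.1) ⬝ᵥ y) + y ⬝ᵥ S.1 *ᵥ y := by
  have h1 := dotProduct_mulVec_comm_of_symm hS x y
  have h2 := dotProduct_comm (S.1 *ᵥ x) y
  simp only [quad, Matrix.mulVec_add, dotProduct_add, add_dotProduct]
  rw [h1, h2]
  ring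

lemma quadForm_transpose_mul_mul (P : Matrix (Fin n) (Fin n) ℝ) (X : Matrix (Fin n) (Fin k) ℝ)
    (v w : Fin k → ℝ) : v ⬝ᵥ (Xᵀ * P * X) *ᵥ w = (X *ᵥ v) ⬝ᵥ P *ᵥ (X *ᵥ w) := by
  simp only [← Matrix.mulVec_mulVec, Matrix.dotProduct_mulVec _ Xᵀ, Matrix.vecMul_transpose]

lemma posSemidef_of_real {P : Matrix (Fin n) (Fin n) ℝ} (hP : Pᵀ = P)
    (h : ∀ x, 0 ≤ x ⬝ᵥ P *ᵥ x) : P.PosSemidef :=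
  Matrix.PosSemidef.of_dotProduct_mulVec_nonneg (by simpa [Matrix.IsHermitian] using hP)
    (by simpa using h)

lemma posSemidef_symm {P : Matrix (Fin n) (Fin n) ℝ} (hP : P.PosSemidef) : Pᵀ = P := by
  simpa [Matrix.IsHermitian] using hP.isHermitian

lemma posSemidef_nonneg {P : Matrix (Fin n) (Fin n) ℝ} (hP : P.PosSemidef) (x : Fin n → ℝ) :
    0 ≤ x ⬝ᵥ P *ᵥ x := by
  simpa using hP.dotProduct_mulVec_nonneg x

lemma posDef_penalty_iff {P : Matrix (Fin n) (Fin n) ℝ} (hP : Pᵀ = P)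
    (X : Matrix (Fin n) (Fin k) ℝ) (lam : ℝ) :
    (lam • (1 : Matrix (Fin k) (Fin k) ℝ) - Xᵀ * P * X).PosDef ↔
      ∀ w, w ≠ 0 → (X *ᵥ w) ⬝ᵥ P *ᵥ (X *ᵥ w) < lam * (w ⬝ᵥ w) := by
  have key : ∀ w : Fin k → ℝ, star w ⬝ᵥ (lam • (1 : Matrix (Fin k) (Fin k) ℝ) - Xᵀ * P * X) *ᵥ w =
      lam * (w ⬝ᵥ w) - (X *ᵥ w) ⬝ᵥ P *ᵥ (X *ᵥ w) := fun w => by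
    rw [star_trivial, Matrix.sub_mulVec, dotProduct_sub, quadForm_transpose_mul_mul,
      Matrix.smul_mulVec, Matrix.one_mulVec, dotProduct_smul, smul_eq_mul]
  constructor
  · intro h w hw
    have := h.dotProduct_mulVec_pos hw
    rw [key] at this
    linarith
  · intro h
    refine Matrix.PosDef.of_dotProduct_mulVec_pos ?_ fun w hw => ?_
    · simp [Matrix.IsHermitian, Matrix.mul_assoc, hP]
    · rw [key]
      linarith [h w hw]

namespace Data

variable (D : Data n m k N)

lemma dotProduct_Phi (lam : ℝ) (p q : Fin n → ℝ) :
    p ⬝ᵥ D.Phi lam *ᵥ q = (D.Bᵀ *ᵥ p) ⬝ᵥ D.R⁻¹ *ᵥ (D.Bᵀ *ᵥ q) -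
      (1 / lam) * ((D.Xiᵀ *ᵥ p) ⬝ᵥ (D.Xiᵀ *ᵥ q)) := by
  rw [Phi, Matrix.sub_mulVec, dotProduct_sub, Matrix.smul_mulVec, dotProduct_smul, smul_eq_mul,
    ← Matrix.mulVec_mulVec, ← Matrix.mulVec_mulVec, ← Matrix.mulVec_mulVec,
    dotProduct_mulVec_transpose D.B, dotProduct_mulVec_transpose D.Xi]

lemma Phi_transpose (hR : D.R.PosDef) (lam : ℝ) : (D.Phi lam)ᵀ = D.Phi lam := by
  have : D.Rᵀ = D.R := posSemidef_symm hR.posSemidef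
  simp [Phi, Matrix.transpose_nonsing_inv, this, Matrix.mul_assoc]

/-- The costate bound `|Ξᵀ P x|² / lam ≤ xᵀ P x`, strict unless `Ξᵀ P x = 0`. -/
lemma costate_bound {P : Matrix (Fin n) (Fin n) ℝ} (hP : P.PosSemidef) {lam : ℝ} (hlam : 0 < lam)
    (hH : (lam • (1 : Matrix (Fin k) (Fin k) ℝ) - D.Xiᵀ * P * D.Xi).PosDef) (x : Fin n → ℝ) :
    (1 / lam) * ((D.Xiᵀ *ᵥ (P *ᵥ x)) ⬝ᵥ (D.Xiᵀ *ᵥ (P *ᵥ x))) ≤ x ⬝ᵥ P *ᵥ x ∧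
      (D.Xiᵀ *ᵥ (P *ᵥ x) ≠ 0 →
        (1 / lam) * ((D.Xiᵀ *ᵥ (P *ᵥ x)) ⬝ᵥ (D.Xiᵀ *ᵥ (P *ᵥ x))) < x ⬝ᵥ P *ᵥ x) := by
  set v := D.Xiᵀ *ᵥ (P *ᵥ x) with hv
  have hsymm := posSemidef_symm hP
  -- Expanding gives `xᵀPx ≥ (2/lam)|v|² - (1/lam²)(Ξv)ᵀP(Ξv)`, and the penalty condition bounds the
  -- last term by `|v|²/lam`.
  have h0 := posSemidef_nonneg hP (x - (1 / lam) • (D.Xi *ᵥ v))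
  have h1 : (D.Xi *ᵥ v) ⬝ᵥ P *ᵥ x = v ⬝ᵥ v := by
    rw [dotProduct_comm, dotProduct_mulVec_transpose, ← hv]
  have h2 : x ⬝ᵥ P *ᵥ (D.Xi *ᵥ v) = v ⬝ᵥ v := by
    rw [dotProduct_mulVec_comm_of_symm hsymm, h1]
  simp only [Matrix.mulVec_sub, Matrix.mulVec_smul, sub_dotProduct, dotProduct_sub,
    smul_dotProduct, dotProduct_smul, smul_eq_mul, h1, h2] at h0
  set g := (D.Xi *ᵥ v) ⬝ᵥ P *ᵥ (D.Xi *ᵥ v)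
  have h3 : (1 / lam) * ((1 / lam) * (lam * (v ⬝ᵥ v))) = (1 / lam) * (v ⬝ᵥ v) := by
    field_simp
  have hl : 0 < 1 / lam := by positivity
  have hlt : v ≠ 0 → (1 / lam) * (v ⬝ᵥ v) < x ⬝ᵥ P *ᵥ x := by
    intro hv0
    have h4 : g < lam * (v ⬝ᵥ v) := (posDef_penalty_iff hsymm D.Xi lam).1 hH v hv0
    have h5 : (1 / lam) * ((1 / lam) * g) < (1 / lam) * ((1 / lam) * (lam * (v ⬝ᵥ v))) := by
      gcongr
    linarith
  refine ⟨?_, hlt⟩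
  by_cases hv0 : v = 0
  · simpa [hv0] using posSemidef_nonneg hP x
  · exact (hlt hv0).le

/-- Only the disturbance part of `Φ` is negative, and the costate bound absorbs it. The expression
is the form `yᵀWy` of the Riccati kernel `W = (1 + PΦ)⁻¹P` at `y = x + ΦPx`. -/
lemma costate_nonneg (hR : D.R.PosDef) {P : Matrix (Fin n) (Fin n) ℝ} (hP : P.PosSemidef)
    {lam : ℝ} (hlam : 0 < lam)
    (hH : (lam • (1 : Matrix (Fin k) (Fin k) ℝ) - D.Xiᵀ * P * D.Xi).PosDef) (x : Fin n → ℝ) :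
    0 ≤ x ⬝ᵥ P *ᵥ x + (P *ᵥ x) ⬝ᵥ D.Phi lam *ᵥ (P *ᵥ x) := by
  rw [D.dotProduct_Phi]
  have h1 := (D.costate_bound hP hlam hH x).1
  have h2 := posSemidef_nonneg hR.inv.posSemidef (D.Bᵀ *ᵥ (P *ᵥ x))
  linarith

/-- A kernel vector is a costate: `p = Px` with `x = -Φp`, so that `xᵀPx + (Bᵀp)ᵀR⁻¹(Bᵀp) =
|Ξᵀp|²/lam`. The strict costate bound forces `Ξᵀp = 0`, hence `xᵀPx = 0` and `p = Px = 0`. -/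
lemma isUnit_one_add_mul_Phi (hR : D.R.PosDef) {P : Matrix (Fin n) (Fin n) ℝ}
    (hP : P.PosSemidef) {lam : ℝ} (hlam : 0 < lam)
    (hH : (lam • (1 : Matrix (Fin k) (Fin k) ℝ) - D.Xiᵀ * P * D.Xi).PosDef) :
    IsUnit (1 + P * D.Phi lam) := by
  rw [← Matrix.mulVec_injective_iff_isUnit]
  refine (injective_iff_map_eq_zero (Matrix.mulVecLin (1 + P * D.Phi lam))).2 fun p hp => ?_
  rw [Matrix.mulVecLin_apply, Matrix.add_mulVec, Matrix.one_mulVec, ← Matrix.mulVec_mulVec] at hp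
  set x := -(D.Phi lam *ᵥ p) with hx
  have hpx : P *ᵥ x = p := by
    rw [hx, Matrix.mulVec_neg]
    exact (eq_neg_of_add_eq_zero_left hp).symm
  have h1 : x ⬝ᵥ P *ᵥ x = -(p ⬝ᵥ D.Phi lam *ᵥ p) := by
    rw [hpx, hx, neg_dotProduct, dotProduct_comm]
  rw [D.dotProduct_Phi] at h1
  have h2 := posSemidef_nonneg hR.inv.posSemidef (D.Bᵀ *ᵥ p)
  have h3 := D.costate_bound hP hlam hH x
  rw [hpx] at h3
  have h4 : D.Xiᵀ *ᵥ p = 0 := by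
    by_contra h
    have := h3.2 h
    rw [hpx] at h1
    linarith
  have h5 := posSemidef_nonneg hP x
  rw [h4, zero_dotProduct] at h1
  have h6 : x ⬝ᵥ P *ᵥ x = 0 := by linarith
  rw [← hpx]
  simpa using (hP.dotProduct_mulVec_zero_iff x).1 (by simpa using h6)

lemma isUnit_one_sub_gain {P : Matrix (Fin n) (Fin n) ℝ} {lam : ℝ} (hlam : 0 < lam)
    (hH : (lam • (1 : Matrix (Fin k) (Fin k) ℝ) - D.Xiᵀ * P * D.Xi).PosDef) :
    IsUnit (1 - (1 / lam) • (D.Xiᵀ * P * D.Xi)) := by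
  have h : (1 : Matrix (Fin k) (Fin k) ℝ) - (1 / lam) • (D.Xiᵀ * P * D.Xi) =
      (1 / lam) • (lam • (1 : Matrix (Fin k) (Fin k) ℝ) - D.Xiᵀ * P * D.Xi) := by
    rw [smul_sub, smul_smul, one_div_mul_cancel hlam.ne', one_smul]
  rw [h]
  exact (Matrix.PosDef.smul hH (by positivity)).isUnit

lemma isUnit_one_sub_mul {P : Matrix (Fin n) (Fin n) ℝ} {lam : ℝ}
    (h : IsUnit (1 - (1 / lam) • (D.Xiᵀ * P * D.Xi))) :
    IsUnit (1 - (1 / lam) • (P * D.Xi * D.Xiᵀ)) := by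
  rw [Matrix.isUnit_iff_isUnit_det] at h ⊢
  have h1 : (1 / lam) • (P * D.Xi * D.Xiᵀ) = ((1 / lam) • (P * D.Xi)) * D.Xiᵀ := by
    rw [Matrix.smul_mul]
  rw [h1, Matrix.det_one_sub_mul_comm]
  rwa [Matrix.mul_smul, ← Matrix.mul_assoc]

end Data

/-! ### The saddle point of the stage game. -/

/-- A triple of the Riccati recursion. -/
abbrev Triple (n : ℕ) : Type := Matrix (Fin n) (Fin n) ℝ × (Fin n → ℝ) × ℝ

lemma avg_dotProduct (c : Fin k → ℝ) (a : Fin N → Fin k → ℝ) :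
    avg (fun i => c ⬝ᵥ a i) = c ⬝ᵥ ((N : ℝ)⁻¹ • ∑ i, a i) := by
  rw [avg, dotProduct_smul, dotProduct_sum, smul_eq_mul]

namespace Data

variable (D : Data n m k N)

/-- The quadratic form `Ξᵀ P Ξ`. -/
def gain (S : Triple n) : Matrix (Fin k) (Fin k) ℝ := D.Xiᵀ * S.1 * D.Xi

/-- The deviation of the saddle disturbance caused by a sample deviation, up to the factor
`1 / lam`. -/
def spread (lam : ℝ) (S : Triple n) : Matrix (Fin k) (Fin k) ℝ :=
  (1 - (1 / lam) • D.gain S)⁻¹ * D.gain S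

/-- The costate at the saddle point. -/
def costate (lam : ℝ) (t : ℕ) (S : Triple n) (x : Fin n → ℝ) : Fin n → ℝ :=
  (1 + S.1 * D.Phi lam)⁻¹ *ᵥ (S.1 *ᵥ (D.A *ᵥ x + D.Xi *ᵥ D.wbar t) + S.2.1)

/-- The saddle control. -/
def saddleControl (lam : ℝ) (t : ℕ) (S : Triple n) (x : Fin n → ℝ) : Fin m → ℝ :=
  -(D.R⁻¹ *ᵥ (D.Bᵀ *ᵥ D.costate lam t S x))

/-- The part of the saddle shift that depends on the sample point. -/
def sampleShift (lam : ℝ) (t : ℕ) (S : Triple n) (i : Fin N) : Fin k → ℝ :=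
  (1 / lam) • (D.spread lam S *ᵥ (D.what t i - D.wbar t))

/-- The saddle shift of the sample point `i`. -/
def saddleShift (lam : ℝ) (t : ℕ) (S : Triple n) (x : Fin n → ℝ) (i : Fin N) : Fin k → ℝ :=
  (1 / lam) • (D.Xiᵀ *ᵥ D.costate lam t S x) + D.sampleShift lam t S i

/-- The mean successor state at the saddle point. -/
def saddleMean (lam : ℝ) (t : ℕ) (S : Triple n) (x : Fin n → ℝ) : Fin n → ℝ :=
  D.A *ᵥ x + D.Xi *ᵥ D.wbar t - D.Phi lam *ᵥ D.costate lam t S x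

/-- The successor state at the saddle point from the sample point `i`. -/
def saddleNext (lam : ℝ) (t : ℕ) (S : Triple n) (x : Fin n → ℝ) (i : Fin N) : Fin n → ℝ :=
  D.next x (D.saddleControl lam t S x) (D.what t i + D.saddleShift lam t S x i)

/-- The penalized value at the saddle point from the sample point `i`. -/
def saddlePayoff (lam : ℝ) (t : ℕ) (S : Triple n) (x : Fin n → ℝ) (i : Fin N) : ℝ :=
  quad S (D.saddleNext lam t S x i) -
    lam * (D.saddleShift lam t S x i ⬝ᵥ D.saddleShift lam t S x i)

lemma continuous_costate (lam : ℝ) (t : ℕ) (S : Triple n) : Continuous (D.costate lam t S) := by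
  unfold costate
  fun_prop

lemma continuous_saddleControl (lam : ℝ) (t : ℕ) (S : Triple n) :
    Continuous (D.saddleControl lam t S) := by
  have := D.continuous_costate lam t S
  unfold saddleControl
  fun_prop

lemma continuous_saddleShift (lam : ℝ) (t : ℕ) (S : Triple n) (i : Fin N) :
    Continuous fun x => D.saddleShift lam t S x i := by
  have := D.continuous_costate lam t S
  unfold saddleShift
  fun_prop

/-- A triple from which a step of the recursion with parameter `lam` is a well-posed game. -/
structure IsRegular (lam : ℝ) (S : Triple n) : Prop where
  posSemidef : S.1.PosSemidef
  nonneg : ∀ x, 0 ≤ quad S x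
  penalty : (lam • (1 : Matrix (Fin k) (Fin k) ℝ) - D.Xiᵀ * S.1 * D.Xi).PosDef

variable {D} {lam : ℝ} {S : Triple n}

lemma IsRegular.symm (h : D.IsRegular lam S) : S.1ᵀ = S.1 := posSemidef_symm h.posSemidef

lemma avg_sample_dotProduct (hN : 0 < N) (c : Fin k → ℝ) (t : ℕ) :
    avg (fun i => c ⬝ᵥ (D.what t i - D.wbar t)) = 0 := by
  simp only [dotProduct_sub]
  rw [avg_sub, avg_const hN, avg_dotProduct, wbar, sub_self]

/-- The fixed-point equation of the sample shift. -/
lemma smul_sampleShift (hlam : 0 < lam) (h : D.IsRegular lam S) (t : ℕ) (i : Fin N) :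
    lam • D.sampleShift lam t S i =
      D.gain S *ᵥ (D.what t i - D.wbar t + D.sampleShift lam t S i) := by
  have hu := isUnit_one_sub_gain D hlam h.penalty
  have h1 : (1 - (1 / lam) • D.gain S) * D.spread lam S = D.gain S := by
    rw [spread, ← Matrix.mul_assoc, gain, Matrix.mul_nonsing_inv _
      ((Matrix.isUnit_iff_isUnit_det _).1 hu), Matrix.one_mul]
  have h2 : D.spread lam S = D.gain S + (1 / lam) • (D.gain S * D.spread lam S) := by
    rw [Matrix.sub_mul, Matrix.one_mul, Matrix.smul_mul] at h1
    exact sub_eq_iff_eq_add.1 h1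
  rw [sampleShift, smul_smul, mul_one_div_cancel hlam.ne', one_smul, Matrix.mulVec_add,
    Matrix.mulVec_smul, Matrix.mulVec_mulVec, ← Matrix.smul_mulVec, ← Matrix.add_mulVec, ← h2]

/-- The costate is half the gradient of the cost-to-go at the mean successor: `P(y - Φp) + r = p`
rearranges the equation `(1 + PΦ)p = Py + r` that defines it. -/
lemma mulVec_saddleMean (hR : D.R.PosDef) (hlam : 0 < lam) (h : D.IsRegular lam S) (t : ℕ)
    (x : Fin n → ℝ) : S.1 *ᵥ D.saddleMean lam t S x + S.2.1 = D.costate lam t S x := by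
  have hu := D.isUnit_one_add_mul_Phi hR h.posSemidef hlam h.penalty
  have h1 : (1 + S.1 * D.Phi lam) *ᵥ D.costate lam t S x =
      S.1 *ᵥ (D.A *ᵥ x + D.Xi *ᵥ D.wbar t) + S.2.1 := by
    rw [costate, Matrix.mulVec_mulVec,
      Matrix.mul_nonsing_inv _ ((Matrix.isUnit_iff_isUnit_det _).1 hu), Matrix.one_mulVec]
  rw [Matrix.add_mulVec, Matrix.one_mulVec, ← Matrix.mulVec_mulVec] at h1
  rw [saddleMean, Matrix.mulVec_sub, sub_add_eq_add_sub, ← h1, add_sub_cancel_right]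

/-- The control and the common part of the shift together contribute `-Φp`; the sample point enters
only through its centred deviation, which averages to zero. -/
lemma saddleNext_eq (t : ℕ) (x : Fin n → ℝ) (i : Fin N) :
    D.saddleNext lam t S x i = D.saddleMean lam t S x +
      D.Xi *ᵥ (D.what t i - D.wbar t + D.sampleShift lam t S i) := by
  simp only [saddleNext, next, saddleControl, saddleShift, saddleMean, Phi, Matrix.mulVec_add,
    Matrix.sub_mulVec, Matrix.mulVec_sub, Matrix.mulVec_neg, Matrix.smul_mulVec,
    Matrix.mulVec_smul, ← Matrix.mulVec_mulVec]
  abel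

/-- Stationarity in the disturbance. -/
lemma stationary_shift (hR : D.R.PosDef) (hlam : 0 < lam) (h : D.IsRegular lam S) (t : ℕ)
    (x : Fin n → ℝ) (i : Fin N) :
    D.Xiᵀ *ᵥ (S.1 *ᵥ D.saddleNext lam t S x i + S.2.1) = lam • D.saddleShift lam t S x i := by
  rw [saddleNext_eq, Matrix.mulVec_add S.1, add_right_comm, mulVec_saddleMean hR hlam h,
    saddleShift, smul_add, smul_smul, mul_one_div_cancel hlam.ne', one_smul,
    smul_sampleShift hlam h, Matrix.mulVec_add, gain]
  simp only [Matrix.mulVec_mulVec, Matrix.mul_assoc]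

/-- Against the saddle control no disturbance does better than the saddle disturbance. -/
lemma quad_next_le (hR : D.R.PosDef) (hlam : 0 < lam) (h : D.IsRegular lam S) (t : ℕ)
    (x : Fin n → ℝ) (i : Fin N) (w : Fin k → ℝ) :
    quad S (D.next x (D.saddleControl lam t S x) w) ≤
      D.saddlePayoff lam t S x i + lam * ((w - D.what t i) ⬝ᵥ (w - D.what t i)) := by
  set d := D.saddleShift lam t S x i with hd
  -- In the expansion about the saddle disturbance the terms linear in `e` cancel by stationarity,
  -- and the penalty dominates the quadratic term.
  obtain ⟨e, rfl⟩ : ∃ e, w = D.what t i + d + e := ⟨w - (D.what t i + d), by abel⟩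
  have h1 : D.next x (D.saddleControl lam t S x) (D.what t i + d + e) =
      D.saddleNext lam t S x i + D.Xi *ᵥ e := by
    simp only [saddleNext, next, Matrix.mulVec_add, ← hd]
    abel
  have h2 : (D.Xi *ᵥ e) ⬝ᵥ S.1 *ᵥ (D.Xi *ᵥ e) ≤ lam * (e ⬝ᵥ e) := by
    by_cases he : e = 0
    · simp [he]
    · exact ((posDef_penalty_iff h.symm D.Xi lam).1 h.penalty e he).le
  have h3 : D.what t i + d + e - D.what t i = d + e := by abel
  rw [h1, quad_add h.symm, dotProduct_mulVec_transpose, stationary_shift hR hlam h, ← hd, h3,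
    saddlePayoff, ← hd, smul_dotProduct, smul_eq_mul]
  simp only [dotProduct_add, add_dotProduct, dotProduct_comm e d]
  linarith

/-- Against the saddle disturbance no control does better than the saddle control. -/
lemma saddle_le_stage (hN : 0 < N) (hR : D.R.PosDef) (hlam : 0 < lam) (h : D.IsRegular lam S)
    (t : ℕ) (x : Fin n → ℝ) (v : Fin m → ℝ) :
    D.stageCost x (D.saddleControl lam t S x) + avg (D.saddlePayoff lam t S x) ≤
      D.stageCost x v + avg (fun i => quad S (D.next x v (D.what t i + D.saddleShift lam t S x i)) -
        lam * (D.saddleShift lam t S x i ⬝ᵥ D.saddleShift lam t S x i)) := by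
  set u := D.saddleControl lam t S x with hu
  obtain ⟨e, rfl⟩ : ∃ e, v = u + e := ⟨v - u, by abel⟩
  have h1 : ∀ i, D.next x (u + e) (D.what t i + D.saddleShift lam t S x i) =
      D.saddleNext lam t S x i + D.B *ᵥ e := fun i => by
    simp only [saddleNext, next, Matrix.mulVec_add, ← hu]
    abel
  set p := D.costate lam t S x with hp
  have h2 : ∀ i, saddlePayoff D lam t S x i + 2 * (p ⬝ᵥ D.B *ᵥ e) + 2 * ((D.B *ᵥ e) ⬝ᵥ S.1 *ᵥ
      (D.Xi *ᵥ (D.what t i - D.wbar t + D.sampleShift lam t S i))) ≤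
      quad S (D.next x (u + e) (D.what t i + D.saddleShift lam t S x i)) -
        lam * (D.saddleShift lam t S x i ⬝ᵥ D.saddleShift lam t S x i) := fun i => by
    have hnn := posSemidef_nonneg h.posSemidef (D.B *ᵥ e)
    have hg : S.1 *ᵥ D.saddleNext lam t S x i + S.2.1 = p + S.1 *ᵥ
      (D.Xi *ᵥ (D.what t i - D.wbar t + D.sampleShift lam t S i)) := by
      rw [saddleNext_eq, Matrix.mulVec_add, add_right_comm, mulVec_saddleMean hR hlam h]
    rw [h1, quad_add h.symm, hg, add_dotProduct, saddlePayoff, dotProduct_comm (S.1 *ᵥ _) (D.B *ᵥ e)]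
    linarith
  -- Only the mean gradient `2p` survives averaging; it cancels against the control cost because `Ru
  -- = -Bᵀp`.
  have h3 : avg (fun i => 2 * ((D.B *ᵥ e) ⬝ᵥ S.1 *ᵥ
      (D.Xi *ᵥ (D.what t i - D.wbar t + D.sampleShift lam t S i)))) = 0 := by
    have : ∀ i, 2 * ((D.B *ᵥ e) ⬝ᵥ S.1 *ᵥ
      (D.Xi *ᵥ (D.what t i - D.wbar t + D.sampleShift lam t S i))) =
      ((2 : ℝ) • ((D.B *ᵥ e) ᵥ* (S.1 * D.Xi * (1 + (1 / lam) • D.spread lam S)))) ⬝ᵥ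
        (D.what t i - D.wbar t) := fun i => by
      rw [smul_dotProduct, ← Matrix.dotProduct_mulVec, sampleShift]
      simp only [← Matrix.mulVec_mulVec, Matrix.add_mulVec, Matrix.one_mulVec, Matrix.smul_mulVec,
        smul_eq_mul]
    simp only [this]
    exact avg_sample_dotProduct hN _ t
  have h4 := avg_mono h2
  rw [avg_add, avg_add, avg_const hN, h3] at h4
  have h5 : D.stageCost x (u + e) = D.stageCost x u + 2 * (e ⬝ᵥ D.R *ᵥ u) + e ⬝ᵥ D.R *ᵥ e := by
    have := dotProduct_mulVec_comm_of_symm (posSemidef_symm hR.posSemidef) u e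
    simp only [stageCost, Matrix.mulVec_add, dotProduct_add, add_dotProduct, this]
    ring
  have h6 : e ⬝ᵥ D.R *ᵥ u = -(p ⬝ᵥ D.B *ᵥ e) := by
    rw [hu, saddleControl, Matrix.mulVec_neg, Matrix.mulVec_mulVec,
      Matrix.mul_nonsing_inv _ ((Matrix.isUnit_iff_isUnit_det _).1 hR.isUnit), Matrix.one_mulVec,
      dotProduct_neg, dotProduct_comm e, ← dotProduct_mulVec_transpose]
  have h7 := posSemidef_nonneg hR.posSemidef e
  rw [h5, h6]
  change D.stageCost x u + avg (fun i => D.saddlePayoff lam t S x i) ≤ _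
  linarith

/-- The mean of a quadratic form over the centred sample. -/
lemma avg_quadForm_sample (hN : 0 < N) (W : Matrix (Fin k) (Fin k) ℝ) (t : ℕ) :
    avg (fun i => (D.what t i - D.wbar t) ⬝ᵥ W *ᵥ (D.what t i - D.wbar t)) =
      (W * D.Sig t).trace - D.wbar t ⬝ᵥ W *ᵥ D.wbar t := by
  have h1 : (W * D.Sig t).trace = avg (fun i => D.what t i ⬝ᵥ W *ᵥ D.what t i) := by
    rw [Sig, Matrix.mul_smul, Matrix.trace_smul, Matrix.mul_sum, Matrix.trace_sum, avg, smul_eq_mul]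
    refine congrArg _ (Finset.sum_congr rfl fun i _ => ?_)
    rw [Matrix.mul_vecMulVec, Matrix.trace_vecMulVec, dotProduct_comm]
  have h2 : ∀ i, (D.what t i - D.wbar t) ⬝ᵥ W *ᵥ (D.what t i - D.wbar t) =
      D.what t i ⬝ᵥ W *ᵥ D.what t i - D.wbar t ⬝ᵥ W *ᵥ D.wbar t -
      (W *ᵥ D.wbar t + D.wbar t ᵥ* W) ⬝ᵥ (D.what t i - D.wbar t) := fun i => by
    simp only [Matrix.mulVec_sub, dotProduct_sub, sub_dotProduct, add_dotProduct,
      ← Matrix.dotProduct_mulVec, dotProduct_comm (W *ᵥ D.wbar t)]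
    ring
  simp only [h2]
  rw [avg_sub, avg_sub, avg_const hN, avg_sample_dotProduct hN, h1, sub_zero]

/-- With `e` the sample deviation, `s` its shift and `q = Ξᵀp`, the fixed-point equation turns the
second-order term into `lam (e + s)·s`. The terms `lam s·s` and `2 q·s` then cancel against the
penalty. -/
lemma saddlePayoff_eq (hR : D.R.PosDef) (hlam : 0 < lam) (h : D.IsRegular lam S) (t : ℕ)
    (x : Fin n → ℝ) (i : Fin N) :
    D.saddlePayoff lam t S x i = quad S (D.saddleMean lam t S x) -
      (1 / lam) * ((D.Xiᵀ *ᵥ D.costate lam t S x) ⬝ᵥ (D.Xiᵀ *ᵥ D.costate lam t S x)) +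
      (2 : ℝ) • (D.Xiᵀ *ᵥ D.costate lam t S x) ⬝ᵥ (D.what t i - D.wbar t) +
      (D.what t i - D.wbar t) ⬝ᵥ D.spread lam S *ᵥ (D.what t i - D.wbar t) := by
  have h1 : (D.what t i - D.wbar t) ⬝ᵥ D.spread lam S *ᵥ (D.what t i - D.wbar t) =
      lam * (D.sampleShift lam t S i ⬝ᵥ (D.what t i - D.wbar t)) := by
    rw [sampleShift, smul_dotProduct, smul_eq_mul, ← mul_assoc, mul_one_div_cancel hlam.ne',
      one_mul, dotProduct_comm]
  have h2 := smul_sampleShift hlam h t i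
  rw [h1, saddlePayoff, saddleNext_eq, quad_add h.symm, mulVec_saddleMean hR hlam h,
    ← quadForm_transpose_mul_mul]
  change _ + _ ⬝ᵥ D.gain S *ᵥ _ - _ = _
  rw [← h2, dotProduct_mulVec_transpose, saddleShift]
  set q := D.Xiᵀ *ᵥ D.costate lam t S x
  set e := D.what t i - D.wbar t
  set s := D.sampleShift lam t S i
  simp only [dotProduct_add, add_dotProduct, dotProduct_smul, smul_dotProduct, smul_eq_mul,
    dotProduct_comm s q, dotProduct_comm s e]
  field_simp
  ring

/-- The push-through identity `(1 + PΦ)⁻¹P = P(1 + ΦP)⁻¹`, whose right side is the transpose of the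
left. -/
lemma riccatiKernel_transpose (hR : D.R.PosDef) (hlam : 0 < lam) (h : D.IsRegular lam S) :
    ((1 + S.1 * D.Phi lam)⁻¹ * S.1)ᵀ = (1 + S.1 * D.Phi lam)⁻¹ * S.1 := by
  have hu := (Matrix.isUnit_iff_isUnit_det _).1
    (D.isUnit_one_add_mul_Phi hR h.posSemidef hlam h.penalty)
  have hPhiT := D.Phi_transpose hR lam
  set M := (1 + S.1 * D.Phi lam)⁻¹ with hM
  have hMT1 : (1 + D.Phi lam * S.1) * Mᵀ = 1 := by
    have : M * (1 + S.1 * D.Phi lam) = 1 := Matrix.nonsing_inv_mul _ hu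
    have := congrArg Matrix.transpose this
    simpa [Matrix.transpose_mul, hPhiT, h.symm] using this
  rw [Matrix.transpose_mul, h.symm]
  symm
  calc M * S.1 = M * (S.1 * ((1 + D.Phi lam * S.1) * Mᵀ)) := by rw [hMT1, Matrix.mul_one]
    _ = M * (1 + S.1 * D.Phi lam) * (S.1 * Mᵀ) := by noncomm_ring
    _ = S.1 * Mᵀ := by rw [Matrix.nonsing_inv_mul _ hu, Matrix.one_mul]

/-- The value of the stage game is given by the Riccati step. -/
lemma saddle_value (hN : 0 < N) (hR : D.R.PosDef) (hlam : 0 < lam) (h : D.IsRegular lam S)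
    (t : ℕ) (x : Fin n → ℝ) :
    D.stageCost x (D.saddleControl lam t S x) + avg (D.saddlePayoff lam t S x) =
      quad (D.riccatiStep lam t S) x := by
  have hu := (Matrix.isUnit_iff_isUnit_det _).1
    (D.isUnit_one_add_mul_Phi hR h.posSemidef hlam h.penalty)
  have hG := isUnit_one_sub_gain D hlam h.penalty
  have hL := (Matrix.isUnit_iff_isUnit_det _).1 (D.isUnit_one_sub_mul hG)
  replace hG := (Matrix.isUnit_iff_isUnit_det _).1 hG
  have hpay : avg (D.saddlePayoff lam t S x) = quad S (D.saddleMean lam t S x) -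
      (1 / lam) * ((D.Xiᵀ *ᵥ D.costate lam t S x) ⬝ᵥ (D.Xiᵀ *ᵥ D.costate lam t S x)) +
      ((D.spread lam S * D.Sig t).trace - D.wbar t ⬝ᵥ D.spread lam S *ᵥ D.wbar t) := by
    have : D.saddlePayoff lam t S x = fun i => D.saddlePayoff lam t S x i := rfl
    rw [this]
    simp only [saddlePayoff_eq hR hlam h]
    rw [avg_add, avg_add, avg_const hN, avg_sample_dotProduct hN, avg_quadForm_sample hN, add_zero]
  set p := D.costate lam t S x with hp
  set b := D.Xi *ᵥ D.wbar t with hb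
  set M := (1 + S.1 * D.Phi lam)⁻¹ with hM
  have hcost : D.stageCost x (D.saddleControl lam t S x) = x ⬝ᵥ D.Q *ᵥ x +
      (D.Bᵀ *ᵥ p) ⬝ᵥ D.R⁻¹ *ᵥ (D.Bᵀ *ᵥ p) := by
    rw [stageCost, saddleControl, ← hp, Matrix.mulVec_neg, Matrix.mulVec_mulVec _ D.R,
      Matrix.mul_nonsing_inv _ ((Matrix.isUnit_iff_isUnit_det _).1 hR.isUnit), Matrix.one_mulVec,
      neg_dotProduct, dotProduct_neg, neg_neg, dotProduct_comm (D.R⁻¹ *ᵥ _)]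
  have hmean : quad S (D.saddleMean lam t S x) =
      (p + S.2.1) ⬝ᵥ (D.A *ᵥ x + b - D.Phi lam *ᵥ p) + S.2.2 := by
    change _ = (p + S.2.1) ⬝ᵥ D.saddleMean lam t S x + _
    rw [hp, ← mulVec_saddleMean hR hlam h t x]
    simp only [quad, add_dotProduct, dotProduct_comm (S.1 *ᵥ _)]
    ring
  have hPhiT := D.Phi_transpose hR lam
  have hMT1 : (1 + D.Phi lam * S.1) * Mᵀ = 1 := by
    have : M * (1 + S.1 * D.Phi lam) = 1 := Matrix.nonsing_inv_mul _ hu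
    have := congrArg Matrix.transpose this
    simpa [Matrix.transpose_mul, hPhiT, h.symm] using this
  have hWT : (M * S.1)ᵀ = M * S.1 := riccatiKernel_transpose hR hlam h
  have hMP : M * S.1 = S.1 * Mᵀ := by
    rw [← hWT, Matrix.transpose_mul, h.symm]
  have hPhiMP : D.Phi lam * (M * S.1) = 1 - Mᵀ := by
    rw [hMP, ← hMT1]
    noncomm_ring
  -- Another push-through identity replaces the `k × k` inverse in `spread` by the `n × n` inverse
  -- of the Riccati step.
  have hspread : D.wbar t ⬝ᵥ D.spread lam S *ᵥ D.wbar t =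
      b ⬝ᵥ ((1 - (1 / lam) • (S.1 * D.Xi * D.Xiᵀ))⁻¹ * S.1) *ᵥ b := by
    have h1 : D.spread lam S =
        D.Xiᵀ * ((1 - (1 / lam) • (S.1 * D.Xi * D.Xiᵀ))⁻¹ * S.1) * D.Xi := by
      set L := 1 - (1 / lam) • (S.1 * D.Xi * D.Xiᵀ) with hLdef
      set K := 1 - (1 / lam) • (D.Xiᵀ * S.1 * D.Xi) with hKdef
      have h2 : L * (S.1 * D.Xi) = S.1 * D.Xi * K := by
        rw [hLdef, hKdef, Matrix.sub_mul, Matrix.mul_sub, Matrix.smul_mul, Matrix.mul_smul]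
        simp [Matrix.mul_assoc]
      have h3 : L⁻¹ * S.1 * D.Xi = S.1 * D.Xi * K⁻¹ := by
        calc L⁻¹ * S.1 * D.Xi = L⁻¹ * (S.1 * D.Xi * K) * K⁻¹ := by
              rw [Matrix.mul_assoc, Matrix.mul_assoc, Matrix.mul_assoc (S.1 * D.Xi),
                Matrix.mul_nonsing_inv _ hG, Matrix.mul_one]
          _ = S.1 * D.Xi * K⁻¹ := by
              rw [← h2, ← Matrix.mul_assoc, Matrix.nonsing_inv_mul _ hL, Matrix.one_mul]
      have h4 : K * (D.Xiᵀ * S.1 * D.Xi) = (D.Xiᵀ * S.1 * D.Xi) * K := by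
        rw [hKdef, Matrix.sub_mul, Matrix.mul_sub, Matrix.smul_mul, Matrix.mul_smul,
          Matrix.one_mul, Matrix.mul_one]
      calc D.spread lam S = K⁻¹ * ((D.Xiᵀ * S.1 * D.Xi) * K) * K⁻¹ := by
            rw [Matrix.mul_assoc, Matrix.mul_assoc (D.Xiᵀ * S.1 * D.Xi),
              Matrix.mul_nonsing_inv _ hG, Matrix.mul_one]
            rfl
        _ = (D.Xiᵀ * S.1 * D.Xi) * K⁻¹ := by
            rw [← h4, ← Matrix.mul_assoc, Matrix.nonsing_inv_mul _ hG, Matrix.one_mul]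
        _ = _ := by
            rw [Matrix.mul_assoc _ (L⁻¹ * S.1), h3]
            simp only [Matrix.mul_assoc]
    rw [h1, quadForm_transpose_mul_mul]
  set y := D.A *ᵥ x + b with hy
  set ρ := M *ᵥ S.2.1 with hρ
  have hpy : p = (M * S.1) *ᵥ y + ρ := by
    rw [hp, costate, Matrix.mulVec_add, Matrix.mulVec_mulVec]
  have hPhip : S.2.1 ⬝ᵥ D.Phi lam *ᵥ p =
      S.2.1 ⬝ᵥ y - ρ ⬝ᵥ y + (S.2.1 ᵥ* D.Phi lam) ⬝ᵥ ρ := by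
    have h1 : S.2.1 ⬝ᵥ Mᵀ *ᵥ y = ρ ⬝ᵥ y := by
      rw [dotProduct_mulVec_transpose, Matrix.transpose_transpose]
    rw [hpy, Matrix.mulVec_add, Matrix.mulVec_mulVec, hPhiMP, Matrix.sub_mulVec, Matrix.one_mulVec,
      dotProduct_add, dotProduct_sub, h1, ← Matrix.dotProduct_mulVec]
  have hstep : quad (D.riccatiStep lam t S) x = x ⬝ᵥ D.Q *ᵥ x + y ⬝ᵥ (M * S.1) *ᵥ y +
      2 * (ρ ⬝ᵥ y) + S.2.2 - (S.2.1 ᵥ* D.Phi lam) ⬝ᵥ ρ + (D.spread lam S * D.Sig t).trace -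
      b ⬝ᵥ ((1 - (1 / lam) • (S.1 * D.Xi * D.Xiᵀ))⁻¹ * S.1) *ᵥ b := by
    have h1 : x ⬝ᵥ (D.Aᵀ * M * S.1 * D.A) *ᵥ x = (D.A *ᵥ x) ⬝ᵥ (M * S.1) *ᵥ (D.A *ᵥ x) := by
      rw [← quadForm_transpose_mul_mul, Matrix.mul_assoc D.Aᵀ]
    have h2 : ((D.Aᵀ * M) *ᵥ (S.1 *ᵥ b + S.2.1)) ⬝ᵥ x =
        (D.A *ᵥ x) ⬝ᵥ (M * S.1) *ᵥ b + ρ ⬝ᵥ (D.A *ᵥ x) := by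
      rw [← Matrix.mulVec_mulVec, ← dotProduct_mulVec_transpose, Matrix.mulVec_add,
        Matrix.mulVec_mulVec, add_dotProduct, dotProduct_comm ((M * S.1) *ᵥ b)]
    have h3 := dotProduct_mulVec_comm_of_symm hWT b (D.A *ᵥ x)
    simp only [quad, riccatiStep]
    rw [← hM, ← hb, ← hρ, Matrix.add_mulVec, dotProduct_add, h1, h2, hy, Matrix.sub_mul,
      Matrix.sub_mulVec, dotProduct_sub, sub_dotProduct, smul_dotProduct, smul_eq_mul]
    simp only [Matrix.mulVec_add, dotProduct_add, add_dotProduct]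
    rw [h3, dotProduct_comm b ρ]
    change _ + (S.2.2 + (D.spread lam S * D.Sig t).trace + _ + _) = _
    ring
  -- The control cost minus the penalty of the common shift is `pᵀΦp`, which cancels the `-pᵀΦp`
  -- from the value at the mean successor.
  have hPhi := D.dotProduct_Phi lam p p
  rw [hcost, hpay, hmean, hstep, hspread]
  simp only [add_dotProduct, dotProduct_sub]
  rw [hPhip]
  have hpy' : p ⬝ᵥ y = y ⬝ᵥ (M * S.1) *ᵥ y + ρ ⬝ᵥ y := by
    conv_lhs => rw [hpy, add_dotProduct, dotProduct_comm ((M * S.1) *ᵥ y)]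
  rw [hpy']
  linarith

/-- The Riccati step preserves positive semidefiniteness. -/
lemma posSemidef_riccatiStep (hQ : D.Q.PosSemidef) (hR : D.R.PosDef) (hlam : 0 < lam)
    (h : D.IsRegular lam S) (t : ℕ) : (D.riccatiStep lam t S).1.PosSemidef := by
  have hu := (Matrix.isUnit_iff_isUnit_det _).1
    (D.isUnit_one_add_mul_Phi hR h.posSemidef hlam h.penalty)
  have hWT := riccatiKernel_transpose hR hlam h
  set W := (1 + S.1 * D.Phi lam)⁻¹ * S.1 with hW
  have h1 : (D.riccatiStep lam t S).1 = D.Q + D.Aᵀ * W * D.A := by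
    simp only [riccatiStep, hW, Matrix.mul_assoc]
  rw [h1]
  refine hQ.add (posSemidef_of_real (by simp [hWT, Matrix.mul_assoc]) fun x => ?_)
  rw [quadForm_transpose_mul_mul]
  set y := D.A *ᵥ x
  set p := W *ᵥ y with hp
  have h2 : (1 + S.1 * D.Phi lam) *ᵥ p = S.1 *ᵥ y := by
    rw [hp, hW, Matrix.mulVec_mulVec, ← Matrix.mul_assoc, Matrix.mul_nonsing_inv _ hu,
      Matrix.one_mul]
  have h3 : S.1 *ᵥ (y - D.Phi lam *ᵥ p) = p := by
    rw [Matrix.mulVec_sub, ← h2, Matrix.add_mulVec, Matrix.one_mulVec, ← Matrix.mulVec_mulVec,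
      add_sub_cancel_right]
  have h4 := D.costate_nonneg hR h.posSemidef hlam h.penalty (y - D.Phi lam *ᵥ p)
  rw [h3, sub_dotProduct, dotProduct_comm (D.Phi lam *ᵥ p)] at h4
  linarith

/-- The opponent may leave the sample point unmoved, at no penalty. -/
lemma saddlePayoff_nonneg (hR : D.R.PosDef) (hlam : 0 < lam) (h : D.IsRegular lam S) (t : ℕ)
    (x : Fin n → ℝ) (i : Fin N) : 0 ≤ D.saddlePayoff lam t S x i := by
  have h1 := quad_next_le hR hlam h t x i (D.what t i)
  rw [sub_self, zero_dotProduct, mul_zero, add_zero] at h1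
  exact (h.nonneg _).trans h1

/-- The Riccati step preserves nonnegativity. -/
lemma quad_riccatiStep_nonneg (hN : 0 < N) (hQ : D.Q.PosSemidef) (hR : D.R.PosDef)
    (hlam : 0 < lam) (h : D.IsRegular lam S) (t : ℕ) (x : Fin n → ℝ) :
    0 ≤ quad (D.riccatiStep lam t S) x := by
  rw [← saddle_value hN hR hlam h]
  refine add_nonneg (D.stageCost_nonneg hQ hR _ _) (avg_nonneg fun i => saddlePayoff_nonneg hR hlam h t x i)

end Data

/-! ### The backward recursion and the value for admissible parameters. -/

namespace Data

variable {D : Data n m k N} {lam : ℝ}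

variable (D lam) in
/-- The triple `(P_t, r_t, z_t)`, for `t ≤ T`. -/
def triple (t : ℕ) : Triple n := D.riccatiToGo lam (D.T - t)

lemma triple_horizon : D.triple lam D.T = (D.Qf, 0, 0) := by simp [triple, riccatiToGo]

lemma triple_step {t : ℕ} (ht : t < D.T) :
    D.triple lam t = D.riccatiStep lam t (D.triple lam (t + 1)) := by
  have h1 : D.T - t = (D.T - (t + 1)) + 1 := by omega
  have h2 : D.T - ((D.T - (t + 1)) + 1) = t := by omega
  simp only [triple]
  rw [h1, riccatiToGo, h2]

lemma quad_triple_horizon (x : Fin n → ℝ) :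
    quad (D.triple lam D.T) x = x ⬝ᵥ D.Qf *ᵥ x := by
  simp [quad, triple_horizon]

variable (D lam) in
/-- The penalty condition at stage `t`. -/
def PenaltyAt (t : ℕ) : Prop :=
  (lam • (1 : Matrix (Fin k) (Fin k) ℝ) - D.Xiᵀ * (D.triple lam t).1 * D.Xi).PosDef

lemma admissible_iff : D.Admissible lam ↔ ∀ t, 1 ≤ t → t ≤ D.T → D.PenaltyAt lam t := by
  simp only [Admissible, Finset.mem_Icc, and_imp]
  rfl

/-- The penalty condition is required strictly after `t` only, so the invariant is still available
at the last stage where the condition fails. -/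
lemma triple_invariant (hN : 0 < N) (hQ : D.Q.PosSemidef) (hQf : D.Qf.PosSemidef)
    (hR : D.R.PosDef) (hlam : 0 < lam) {t : ℕ} (ht : t ≤ D.T)
    (h : ∀ j, t < j → j ≤ D.T → D.PenaltyAt lam j) :
    (D.triple lam t).1.PosSemidef ∧ ∀ x, 0 ≤ quad (D.triple lam t) x := by
  induction ht using Nat.decreasingInduction with
  | self =>
    refine ⟨by rw [triple_horizon]; exact hQf, fun x => ?_⟩
    rw [quad_triple_horizon]
    exact posSemidef_nonneg hQf x
  | of_succ t ht ih =>
    obtain ⟨h1, h2⟩ := ih fun j hj => h j (by omega)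
    have hreg : D.IsRegular lam (D.triple lam (t + 1)) := ⟨h1, h2, h (t + 1) (by omega) ht⟩
    rw [triple_step ht]
    exact ⟨posSemidef_riccatiStep hQ hR hlam hreg t, quad_riccatiStep_nonneg hN hQ hR hlam hreg t⟩

lemma isRegular_triple (hN : 0 < N) (hQ : D.Q.PosSemidef) (hQf : D.Qf.PosSemidef)
    (hR : D.R.PosDef) (hlam : 0 < lam) {t : ℕ} (ht : t ≤ D.T)
    (h : ∀ j, t ≤ j → j ≤ D.T → D.PenaltyAt lam j) : D.IsRegular lam (D.triple lam t) :=
  have h1 := triple_invariant hN hQ hQf hR hlam ht fun j hj => h j hj.le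
  ⟨h1.1, h1.2, h t le_rfl ht⟩

lemma Admissible.isRegular (hN : 0 < N) (hQ : D.Q.PosSemidef) (hQf : D.Qf.PosSemidef)
    (hR : D.R.PosDef) (hlam : 0 < lam) (h : D.Admissible lam) {t : ℕ} (ht : t < D.T) :
    D.IsRegular lam (D.triple lam (t + 1)) :=
  isRegular_triple hN hQ hQf hR hlam ht fun j hj => admissible_iff.1 h j (by omega)

lemma measurable_ofReal_quad (S : Triple n) : Measurable fun x => ENNReal.ofReal (quad S x) :=
  (continuous_quad S).measurable.ennreal_ofReal

/-- The lower bound that the saddle disturbance guarantees in one stage. -/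
lemma ofReal_quad_step_le (hN : 0 < N) (hQ : D.Q.PosSemidef) (hR : D.R.PosDef) (hlam : 0 < lam)
    {S : Triple n} (h : D.IsRegular lam S) (t : ℕ) (x : Fin n → ℝ) (v : Fin m → ℝ) :
    ENNReal.ofReal (quad (D.riccatiStep lam t S) x) + ENNReal.ofReal lam *
        ENNReal.ofReal (avg fun i => D.saddleShift lam t S x i ⬝ᵥ D.saddleShift lam t S x i) ≤
      ENNReal.ofReal (D.stageCost x v) + (N : ℝ≥0∞)⁻¹ *
        ∑ i, ENNReal.ofReal (quad S (D.next x v (D.what t i + D.saddleShift lam t S x i))) := by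
  have h1 := saddle_le_stage hN hR hlam h t x v
  rw [saddle_value hN hR hlam h, avg_sub, avg_const_mul] at h1
  rw [← ofReal_avg hN fun i => h.nonneg _,
    ← ENNReal.ofReal_add (D.stageCost_nonneg hQ hR _ _) (avg_nonneg fun i => h.nonneg _),
    ← ENNReal.ofReal_mul hlam.le,
    ← ENNReal.ofReal_add (quad_riccatiStep_nonneg hN hQ hR hlam h t x)
      (mul_nonneg hlam.le (avg_nonneg fun i => dotProduct_self_nonneg _))]
  exact ENNReal.ofReal_le_ofReal (by linarith)

lemma coe_ofReal_div {a b : ℝ} (ha : 0 ≤ a) :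
    ((ENNReal.ofReal a : ℝ≥0∞) : EReal) / (b : EReal) = ((a / b : ℝ) : EReal) := by
  rw [EReal.coe_ennreal_ofReal, max_eq_left ha, EReal.coe_div]

/-- Where the penalty condition holds, the value is given by the Riccati recursion. -/
lemma V_eq_riccatiValue (hN : 0 < N) (hQ : D.Q.PosSemidef)
    (hQf : D.Qf.PosSemidef) (hR : D.R.PosDef) (hlam : 0 < lam) (h : D.Admissible lam)
    (x : Fin n → ℝ) : D.V x lam = (D.riccatiValue x lam : EReal) := by
  have hreg : ∀ t < D.T, D.IsRegular lam (D.triple lam (t + 1)) := fun t ht =>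
    h.isRegular hN hQ hQf hR hlam ht
  have hnn := (triple_invariant hN hQ hQf hR hlam (Nat.zero_le D.T) fun j hj =>
    admissible_iff.1 h j hj).2
  have hval : (D.riccatiValue x lam : EReal) =
      ((ENNReal.ofReal (quad (D.triple lam 0) x) : ℝ≥0∞) : EReal) / ((D.T : ℝ) : EReal) := by
    rw [coe_ofReal_div (hnn x)]
    rfl
  have hmeas : ∀ t, Measurable fun y => ENNReal.ofReal (quad (D.triple lam t) y) := fun t =>
    measurable_ofReal_quad _
  rw [hval]
  refine le_antisymm ?_ ?_
  · refine iInf_le_of_le ⟨fun t => D.saddleControl lam t (D.triple lam (t + 1)), fun t =>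
      (D.continuous_saddleControl lam t _).measurable⟩ (iSup_le fun γ => ?_)
    refine D.J_le hQ hQf hR _ γ x hlam hmeas
      (fun y => by rw [quad_triple_horizon]) fun t ht y => ?_
    have hS := hreg t ht
    -- The dual variables of the Wasserstein bound are the saddle payoffs of the sample points.
    refine ⟨fun i => ENNReal.ofReal (D.saddlePayoff lam t (D.triple lam (t + 1)) y i),
      fun w i => ?_, ?_⟩
    · rw [← ENNReal.ofReal_mul hlam.le, ← ENNReal.ofReal_add (saddlePayoff_nonneg hR hlam hS t y i)
        (mul_nonneg hlam.le (dotProduct_self_nonneg _))]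
      exact ENNReal.ofReal_le_ofReal (quad_next_le hR hlam hS t y i w)
    · rw [← ofReal_avg hN fun i => saddlePayoff_nonneg hR hlam hS t y i,
        ← ENNReal.ofReal_add (D.stageCost_nonneg hQ hR _ _)
          (avg_nonneg fun i => saddlePayoff_nonneg hR hlam hS t y i), triple_step ht]
      exact ENNReal.ofReal_le_ofReal (saddle_value hN hR hlam hS t y).le
  · refine le_iInf fun π => le_iSup_of_le (D.shiftPolicy hN
      (fun t => D.saddleShift lam t (D.triple lam (t + 1)))
      fun t i => (D.continuous_saddleShift lam t _ i).measurable) ?_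
    refine D.le_J_shiftPolicy hQ hQf hR hN _ π x hmeas
      (fun y => by rw [quad_triple_horizon]) fun t ht y => ?_
    rw [triple_step ht]
    exact ofReal_quad_step_le hN hQ hR hlam (hreg t ht) t y _

/-! ### Unbounded cost when the penalty condition fails. -/

variable (D) in
/-- The sign of the linear term of a shift in direction `w` at stage `t`. -/
def shiftSign (S : Triple n) (π : ControlPolicy n m) (t : ℕ) (w : Fin k → ℝ)
    (y : Fin n → ℝ) : ℝ :=
  if 0 ≤ avg (fun i => (S.1 *ᵥ D.next y (π.1 t y) (D.what t i) + S.2.1) ⬝ᵥ D.Xi *ᵥ w)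
  then 1 else -1

lemma measurable_shiftSign (S : Triple n) (π : ControlPolicy n m) (t : ℕ) (w : Fin k → ℝ) :
    Measurable (D.shiftSign S π t w) := by
  refine Measurable.ite (measurableSet_le measurable_const ?_) measurable_const measurable_const
  refine Measurable.const_mul (Finset.measurable_fun_sum _ fun i _ => ?_) _
  have h1 : Continuous fun v : Fin n → ℝ => (S.1 *ᵥ v + S.2.1) ⬝ᵥ D.Xi *ᵥ w := by fun_prop
  exact h1.measurable.comp ((D.measurable_next π t).comp
    (measurable_id.prodMk (measurable_const (a := D.what t i))))

/-- A shift in a direction of large growth. -/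
lemma ofReal_growth_le (hN : 0 < N) {S : Triple n} (hP : S.1.PosSemidef)
    (hnn : ∀ x, 0 ≤ quad S x) (π : ControlPolicy n m) (t : ℕ) {w : Fin k → ℝ}
    (hw : lam * (w ⬝ᵥ w) ≤ (D.Xi *ᵥ w) ⬝ᵥ S.1 *ᵥ (D.Xi *ᵥ w)) {c : ℝ} (hc : 0 ≤ c)
    (y : Fin n → ℝ) :
    ENNReal.ofReal (c ^ 2 * (lam * (w ⬝ᵥ w))) ≤ (N : ℝ≥0∞)⁻¹ * ∑ i, ENNReal.ofReal
      (quad S (D.next y (π.1 t y) (D.what t i + (c * D.shiftSign S π t w y) • w))) := by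
  rw [← ofReal_avg hN fun i => hnn _]
  refine ENNReal.ofReal_le_ofReal ?_
  set σ := D.shiftSign S π t w y with hσ
  set ℓ := avg (fun i => (S.1 *ᵥ D.next y (π.1 t y) (D.what t i) + S.2.1) ⬝ᵥ D.Xi *ᵥ w) with hℓ
  have h1 : σ ^ 2 = 1 ∧ 0 ≤ σ * ℓ := by
    rw [hσ, shiftSign]
    split_ifs with h
    · exact ⟨by norm_num, by simpa only [one_mul] using h⟩
    · exact ⟨by norm_num, by linarith [not_le.1 h]⟩
  have h2 : ∀ i, quad S (D.next y (π.1 t y) (D.what t i + (c * σ) • w)) =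
      quad S (D.next y (π.1 t y) (D.what t i)) + (2 * (c * σ)) *
        ((S.1 *ᵥ D.next y (π.1 t y) (D.what t i) + S.2.1) ⬝ᵥ D.Xi *ᵥ w) +
      c ^ 2 * ((D.Xi *ᵥ w) ⬝ᵥ S.1 *ᵥ (D.Xi *ᵥ w)) := fun i => by
    have : D.next y (π.1 t y) (D.what t i + (c * σ) • w) =
        D.next y (π.1 t y) (D.what t i) + (c * σ) • D.Xi *ᵥ w := by
      simp only [next, Matrix.mulVec_add, Matrix.mulVec_smul]
      abel
    rw [this, quad_add (posSemidef_symm hP)]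
    simp only [Matrix.mulVec_smul, dotProduct_smul, smul_dotProduct, smul_eq_mul]
    linear_combination (c ^ 2 * ((D.Xi *ᵥ w) ⬝ᵥ S.1 *ᵥ (D.Xi *ᵥ w))) * h1.1
  simp only [h2]
  rw [avg_add, avg_add, avg_const hN, avg_const_mul, ← hℓ]
  have h3 : 0 ≤ avg (fun i => quad S (D.next y (π.1 t y) (D.what t i))) :=
    avg_nonneg fun i => hnn _
  have h4 := mul_le_mul_of_nonneg_left hw (sq_nonneg c)
  have h5 := mul_nonneg hc h1.2
  linarith

/-- If the penalty condition for `lam'` fails at some stage, then for every smaller parameter the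
opponent can make the cost of any control policy arbitrarily large. -/
lemma exists_le_J_of_not_penaltyAt (hN : 0 < N) (hQ : D.Q.PosSemidef)
    (hQf : D.Qf.PosSemidef) (hR : D.R.PosDef) (hlam : 0 ≤ lam) {lam' : ℝ} (hlt : lam < lam')
    {τ : ℕ} (hτ : τ < D.T) (hpen : ∀ j, τ + 1 < j → j ≤ D.T → D.PenaltyAt lam' j)
    (hnot : ¬ D.PenaltyAt lam' (τ + 1)) (π : ControlPolicy n m) (x : Fin n → ℝ) :
    ∃ δ : ℝ, 0 < δ ∧ ∀ c : ℝ, 0 ≤ c → ∃ γ : OpponentPolicy n k,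
      ((c ^ 2 * δ / D.T : ℝ) : EReal) ≤ D.J lam π γ x := by
  have hlam' : 0 < lam' := hlam.trans_lt hlt
  obtain ⟨hP, hnn⟩ := triple_invariant hN hQ hQf hR hlam' hτ hpen
  rw [PenaltyAt, posDef_penalty_iff (posSemidef_symm hP)] at hnot
  push Not at hnot
  obtain ⟨w, hw0, hw⟩ := hnot
  have hww : 0 < w ⬝ᵥ w :=
    lt_of_le_of_ne (dotProduct_self_nonneg w) fun h => hw0 (dotProduct_self_eq_zero.1 h.symm)
  refine ⟨(lam' - lam) * (w ⬝ᵥ w), mul_pos (sub_pos.2 hlt) hww, fun c hc => ?_⟩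
  set S := D.triple lam' (τ + 1)
  set d : ℕ → (Fin n → ℝ) → Fin N → Fin k → ℝ := fun s y i =>
    if s < τ then 0 else if s = τ then (c * D.shiftSign S π τ w y) • w
      else D.saddleShift lam' s (D.triple lam' (s + 1)) y i with hd
  have hdm : ∀ s i, Measurable fun y => d s y i := by
    intro s i
    simp only [hd]
    split_ifs
    · exact measurable_const
    · exact ((measurable_shiftSign S π τ w).const_mul c).smul_const w
    · exact (D.continuous_saddleShift lam' s _ i).measurable
  -- At stage `τ` a growth of at least `c² lam' |w|²` is bought for the penalty `c² lam |w|²`, and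
  -- the difference is carried back to time `0` as a constant. After `τ` the cost-to-go functions
  -- for `lam'` stay subharmonic under the smaller penalty `lam`.
  set F : ℕ → (Fin n → ℝ) → ℝ≥0∞ := fun s y =>
    if s ≤ τ then ENNReal.ofReal (c ^ 2 * ((lam' - lam) * (w ⬝ᵥ w)))
      else ENNReal.ofReal (quad (D.triple lam' s) y) with hF
  have hnn0 : 0 ≤ c ^ 2 * ((lam' - lam) * (w ⬝ᵥ w)) :=
    mul_nonneg (sq_nonneg c) (mul_pos (sub_pos.2 hlt) hww).le
  refine ⟨D.shiftPolicy hN d hdm, ?_⟩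
  have hF0 : F 0 x = ENNReal.ofReal (c ^ 2 * ((lam' - lam) * (w ⬝ᵥ w))) := by simp [hF]
  rw [← coe_ofReal_div hnn0, ← hF0]
  refine D.le_J_shiftPolicy hQ hQf hR hN hdm π x (fun s => ?_) (fun y => ?_) fun s hs y => ?_
  · simp only [hF]
    split_ifs
    · exact measurable_const
    · exact measurable_ofReal_quad _
  · simp only [hF, if_neg (not_le.2 hτ), quad_triple_horizon, le_refl]
  · have h0 : (N : ℝ≥0∞)⁻¹ * N = 1 :=
      ENNReal.inv_mul_cancel (by exact_mod_cast hN.ne') (ENNReal.natCast_ne_top N)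
    rcases lt_trichotomy s τ with hsτ | rfl | hsτ
    · have h1 : s + 1 ≤ τ := hsτ
      simp [hF, hd, hsτ, hsτ.le, h1, avg, ← mul_assoc, h0]
    · have h1 : ¬ s + 1 ≤ s := by omega
      have h2 : avg (fun _ : Fin N => ((c * D.shiftSign S π s w y) • w) ⬝ᵥ
          ((c * D.shiftSign S π s w y) • w)) = c ^ 2 * (w ⬝ᵥ w) := by
        have : D.shiftSign S π s w y ^ 2 = 1 := by
          rw [shiftSign]
          split_ifs <;> norm_num
        rw [avg_const hN, smul_dotProduct, dotProduct_smul, smul_eq_mul, smul_eq_mul]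
        linear_combination (c ^ 2 * (w ⬝ᵥ w)) * this
      simp only [hF, hd, lt_irrefl, le_refl, if_true, if_false, h1, h2]
      refine le_trans ?_ ((ofReal_growth_le hN hP hnn π s hw hc y).trans le_add_self)
      rw [← ENNReal.ofReal_mul hlam, ← ENNReal.ofReal_add hnn0 (by positivity)]
      exact ENNReal.ofReal_le_ofReal (by linarith)
    · have h1 : ¬ s ≤ τ := by omega
      have h2 : ¬ s + 1 ≤ τ := by omega
      have h3 : ¬ s < τ := by omega
      have h4 : s ≠ τ := by omega
      simp only [hF, hd, h1, h2, h3, h4, if_false]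
      have hreg : D.IsRegular lam' (D.triple lam' (s + 1)) :=
        isRegular_triple hN hQ hQf hR hlam' hs fun j hj => hpen j (by omega)
      rw [triple_step hs]
      refine le_trans ?_ (ofReal_quad_step_le hN hQ hR hlam' hreg s y _)
      gcongr

/-- A finite value implies the penalty condition for all larger parameters. -/
lemma admissible_of_V_ne_top (hN : 0 < N) (hT : 0 < D.T) (hQ : D.Q.PosSemidef)
    (hQf : D.Qf.PosSemidef) (hR : D.R.PosDef) (hlam : 0 ≤ lam) {lam' : ℝ} (hlt : lam < lam')
    {x : Fin n → ℝ} (hV : D.V x lam ≠ ⊤) : D.Admissible lam' := by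
  obtain ⟨π, hπ⟩ := iInf_lt_iff.1 (lt_top_iff_ne_top.2 hV)
  obtain ⟨b, hb, -⟩ := EReal.lt_iff_exists_real_btwn.1 hπ
  rw [admissible_iff]
  -- Strong induction on the stages to go: where the condition is tested, it already holds at all
  -- later stages.
  have key : ∀ s t, t + s = D.T → 1 ≤ t → D.PenaltyAt lam' t := by
    intro s
    induction s using Nat.strong_induction_on with
    | _ s ih =>
      intro t hts ht
      obtain ⟨τ, rfl⟩ : ∃ τ, t = τ + 1 := ⟨t - 1, by omega⟩
      by_contra hnot
      obtain ⟨δ, hδ, h⟩ := exists_le_J_of_not_penaltyAt hN hQ hQf hR hlam hlt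
        (by omega : τ < D.T) (fun j hj hj' => ih (D.T - j) (by omega) j (by omega) (by omega))
        hnot π x
      have hT' : (0 : ℝ) < D.T := by exact_mod_cast hT
      -- Since `c ≥ 1`, `c²δ ≥ cδ = δ + |b|T > bT`, which exceeds the assumed bound `b`.
      set c := 1 + |b| * D.T / δ with hc
      have hc1 : 1 ≤ c := by
        rw [hc]
        have : 0 ≤ |b| * D.T / δ := by positivity
        linarith
      obtain ⟨γ, hγ⟩ := h c (by linarith)
      have h1 : ((c ^ 2 * δ / D.T : ℝ) : EReal) ≤ (b : EReal) :=
        hγ.trans ((le_iSup (fun γ => D.J lam π γ x) γ).trans hb.le)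
      rw [EReal.coe_le_coe_iff, div_le_iff₀ hT'] at h1
      have h2 : c * δ ≤ c ^ 2 * δ :=
        mul_le_mul_of_nonneg_right (by nlinarith) hδ.le
      have h3 : c * δ = δ + |b| * D.T := by
        rw [hc]
        field_simp
      have h4 : b * D.T ≤ |b| * D.T := by gcongr; exact le_abs_self b
      linarith
  exact fun t ht htT => key (D.T - t) t (by omega) ht

end Data

/-! ### Elementary bounds and finiteness of the value for a large parameter. -/

lemma exists_mulVec_bound (X : Matrix (Fin n) (Fin k) ℝ) :
    ∃ c : ℝ, 0 ≤ c ∧ ∀ v, (X *ᵥ v) ⬝ᵥ (X *ᵥ v) ≤ c * (v ⬝ᵥ v) := by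
  -- The squared Frobenius norm, by Cauchy–Schwarz on each row.
  refine ⟨∑ i, ∑ j, X i j ^ 2, by positivity, fun v => ?_⟩
  rw [Finset.sum_mul, dotProduct]
  refine Finset.sum_le_sum fun i _ => ?_
  have h := Finset.sum_mul_sq_le_sq_mul_sq Finset.univ (X i) v
  have h1 : v ⬝ᵥ v = ∑ j, v j ^ 2 := by simp [dotProduct, sq]
  rw [h1, ← sq]
  exact h

lemma dotProduct_self_add_le (x y : Fin n → ℝ) :
    (x + y) ⬝ᵥ (x + y) ≤ 2 * (x ⬝ᵥ x) + 2 * (y ⬝ᵥ y) := by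
  have h := dotProduct_self_nonneg (x - y)
  simp only [dotProduct_add, add_dotProduct, dotProduct_sub, sub_dotProduct] at h ⊢
  linarith

lemma exists_quadForm_bound (Q : Matrix (Fin n) (Fin n) ℝ) :
    ∃ c : ℝ, 0 ≤ c ∧ ∀ v, v ⬝ᵥ Q *ᵥ v ≤ c * (v ⬝ᵥ v) := by
  obtain ⟨c, hc, h⟩ := exists_mulVec_bound Q
  refine ⟨c + 1, by linarith, fun v => ?_⟩
  have h1 := dotProduct_self_nonneg (v - Q *ᵥ v)
  have h2 := dotProduct_self_nonneg (Q *ᵥ v)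
  have h3 := dotProduct_self_nonneg v
  simp only [dotProduct_sub, sub_dotProduct, dotProduct_comm (Q *ᵥ v) v] at h1
  nlinarith [h v]

/-- The gap between the two sides is `ab (x - y)ᵀP(x - y)`. -/
lemma quadForm_convex {P : Matrix (Fin n) (Fin n) ℝ} (hP : P.PosSemidef) (x y : Fin n → ℝ)
    {a b : ℝ} (ha : 0 ≤ a) (hb : 0 ≤ b) (hab : a + b = 1) :
    (a • x + b • y) ⬝ᵥ P *ᵥ (a • x + b • y) ≤ a * (x ⬝ᵥ P *ᵥ x) + b * (y ⬝ᵥ P *ᵥ y) := by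
  have h := mul_nonneg (mul_nonneg ha hb) (posSemidef_nonneg hP (x - y))
  simp only [Matrix.mulVec_add, Matrix.mulVec_sub, Matrix.mulVec_smul, dotProduct_add,
    add_dotProduct, dotProduct_sub, sub_dotProduct, dotProduct_smul, smul_dotProduct,
    smul_eq_mul] at h ⊢
  obtain rfl : b = 1 - a := by linarith
  linarith

namespace Data

variable {D : Data n m k N} {lam : ℝ}

/-- For a large parameter the zero control policy has a finite value. -/
lemma exists_V_ne_top (hN : 0 < N) (hQ : D.Q.PosSemidef) (hQf : D.Qf.PosSemidef)
    (hR : D.R.PosDef) (x : Fin n → ℝ) : ∃ lam : ℝ, 0 ≤ lam ∧ D.V x lam ≠ ⊤ := by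
  obtain ⟨cA, hcA, hA⟩ := exists_mulVec_bound D.A
  obtain ⟨cX, hcX, hX⟩ := exists_mulVec_bound D.Xi
  obtain ⟨cQ, hcQ, hQb⟩ := exists_quadForm_bound D.Q
  obtain ⟨cf, hcf, hQfb⟩ := exists_quadForm_bound D.Qf
  set c := cQ + cf with hc
  -- The superharmonic functions are `α t |y|² + β t`. From `|Ay + Ξw|² ≤ 2cA|y|² + 4cX|w - ŵ|² +
  -- 4cX|ŵ|²`, the first term requires `cQ + 2cA α (t+1) ≤ α t`, the penalty absorbs the second and
  -- `β` collects the third.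
  set α : ℕ → ℝ := fun t => c * (1 + 2 * cA) ^ (D.T - t) with hα
  have hα0 : ∀ t, 0 ≤ α t := fun t => by positivity
  set a := c * (1 + 2 * cA) ^ D.T with ha
  have hαa : ∀ t, α t ≤ a := fun t => by
    refine mul_le_mul_of_nonneg_left (pow_le_pow_right₀ (by linarith) (Nat.sub_le _ _))
      (by positivity)
  have hαs : ∀ t < D.T, cQ + 2 * cA * α (t + 1) ≤ α t := by
    intro t ht
    have h1 : D.T - t = (D.T - (t + 1)) + 1 := by omega
    have h2 : α t = α (t + 1) + 2 * cA * α (t + 1) := by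
      simp only [hα]
      rw [h1, pow_succ]
      ring
    have h3 : c ≤ α (t + 1) :=
      le_mul_of_one_le_right (by positivity) (one_le_pow₀ (by linarith))
    linarith
  set g : ℕ → Fin N → ℝ := fun t i => a * (4 * cX * (D.what t i ⬝ᵥ D.what t i)) with hg
  have hg0 : ∀ t i, 0 ≤ g t i := fun t i =>
    mul_nonneg (by positivity) (mul_nonneg (by positivity) (dotProduct_self_nonneg _))
  set β : ℕ → ℝ := fun t => ∑ j ∈ Finset.Ico t D.T, avg (g j) with hβ
  have hβ0 : ∀ t, 0 ≤ β t := fun t => Finset.sum_nonneg fun j _ => avg_nonneg (hg0 j)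
  have hβs : ∀ t < D.T, β t = avg (g t) + β (t + 1) := fun t ht =>
    Finset.sum_eq_sum_Ico_succ_bot ht _
  -- `a` bounds every `α t`; the summand `1` makes the parameter positive.
  set lam := 1 + a * (4 * cX) with hlam
  have hlam0 : 0 < lam := by positivity
  have hF0 : ∀ (t : ℕ) (y : Fin n → ℝ), 0 ≤ α t * (y ⬝ᵥ y) + β t := fun t y =>
    add_nonneg (mul_nonneg (hα0 t) (dotProduct_self_nonneg y)) (hβ0 t)
  refine ⟨lam, hlam0.le, ?_⟩
  have hV : D.V x lam ≤ ((ENNReal.ofReal (α 0 * (x ⬝ᵥ x) + β 0) : ℝ≥0∞) : EReal) /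
      ((D.T : ℝ) : EReal) := by
    refine iInf_le_of_le ⟨fun _ _ => 0, fun _ => measurable_const⟩ (iSup_le fun γ => ?_)
    refine D.J_le hQ hQf hR _ γ x hlam0
      (F := fun t y => ENNReal.ofReal (α t * (y ⬝ᵥ y) + β t))
      (fun t => (Continuous.measurable (by fun_prop)).ennreal_ofReal)
      (fun y => ENNReal.ofReal_le_ofReal ?_) fun t ht y => ?_
    · have h1 : α D.T = c := by simp [hα]
      have h2 : cf * (y ⬝ᵥ y) ≤ c * (y ⬝ᵥ y) :=
        mul_le_mul_of_nonneg_right (by linarith) (dotProduct_self_nonneg y)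
      rw [h1]
      linarith [hQfb y, hβ0 D.T]
    · have hyy := dotProduct_self_nonneg y
      have hh0 : ∀ i, 0 ≤ α (t + 1) * (2 * cA * (y ⬝ᵥ y)) + g t i + β (t + 1) := fun i =>
        add_nonneg (add_nonneg (mul_nonneg (hα0 _) (by positivity)) (hg0 t i)) (hβ0 _)
      refine ⟨fun i => ENNReal.ofReal (α (t + 1) * (2 * cA * (y ⬝ᵥ y)) + g t i + β (t + 1)),
        fun w i => ?_, ?_⟩
      · have hee := dotProduct_self_nonneg (w - D.what t i)
        rw [← ENNReal.ofReal_mul hlam0.le,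
          ← ENNReal.ofReal_add (hh0 i) (mul_nonneg hlam0.le hee)]
        refine ENNReal.ofReal_le_ofReal ?_
        have h1 : D.next y 0 w = D.A *ᵥ y + D.Xi *ᵥ w := by simp [next]
        have h2 := dotProduct_self_add_le (D.A *ᵥ y) (D.Xi *ᵥ w)
        have h3 := dotProduct_self_add_le (w - D.what t i) (D.what t i)
        rw [sub_add_cancel] at h3
        have h4 : D.next y 0 w ⬝ᵥ D.next y 0 w ≤ 2 * cA * (y ⬝ᵥ y) + 4 * cX *
            ((w - D.what t i) ⬝ᵥ (w - D.what t i)) + 4 * cX * (D.what t i ⬝ᵥ D.what t i) := by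
          have := mul_le_mul_of_nonneg_left h3 hcX
          rw [h1]
          linarith [hA y, hX w]
        have h5 := mul_le_mul_of_nonneg_left h4 (hα0 (t + 1))
        have h6 : α (t + 1) * (4 * cX * ((w - D.what t i) ⬝ᵥ (w - D.what t i))) ≤
            a * (4 * cX * ((w - D.what t i) ⬝ᵥ (w - D.what t i))) :=
          mul_le_mul_of_nonneg_right (hαa _) (by positivity)
        have h7 : α (t + 1) * (4 * cX * (D.what t i ⬝ᵥ D.what t i)) ≤ g t i :=
          mul_le_mul_of_nonneg_right (hαa _)
            (mul_nonneg (by positivity) (dotProduct_self_nonneg _))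
        have h8 : lam * ((w - D.what t i) ⬝ᵥ (w - D.what t i)) =
          (w - D.what t i) ⬝ᵥ (w - D.what t i) +
            a * (4 * cX * ((w - D.what t i) ⬝ᵥ (w - D.what t i))) := by
          rw [hlam]
          ring
        linarith
      · rw [← ofReal_avg hN hh0, ← ENNReal.ofReal_add (D.stageCost_nonneg hQ hR _ _)
          (avg_nonneg hh0)]
        refine ENNReal.ofReal_le_ofReal ?_
        have h1 : D.stageCost y 0 = y ⬝ᵥ D.Q *ᵥ y := by simp [stageCost]
        have h2 : avg (fun i => g t i) = avg (g t) := rfl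
        rw [avg_add, avg_add, avg_const hN, avg_const hN, hβs t ht, h2]
        have h3 := mul_le_mul_of_nonneg_right (hαs t ht) hyy
        have h4 : D.stageCost y (0 : Fin m → ℝ) ≤ cQ * (y ⬝ᵥ y) := h1 ▸ hQb y
        change D.stageCost y 0 + _ ≤ _
        linarith
  rw [coe_ofReal_div (hF0 0 x)] at hV
  exact (hV.trans_lt (EReal.coe_lt_top _)).ne

/-! ### The threshold. -/

lemma V_antitone (x : Fin n → ℝ) {lam lam' : ℝ} (h : lam ≤ lam') : D.V x lam' ≤ D.V x lam := by
  refine iInf_mono fun π => iSup_mono fun γ => ?_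
  refine EReal.div_le_div_right_of_nonneg (by simp) (EReal.sub_le_sub le_rfl ?_)
  rw [EReal.coe_ennreal_le_coe_ennreal_iff]
  gcongr

lemma lamHat_nonneg : 0 ≤ D.lamHat := Real.sInf_nonneg fun _ h => h.1

/-- At the horizon the condition reads `-ΞᵀQfΞ ≻ 0`, which forces `k = 0`, and then every condition
is vacuous. This covers the parameter `0`, where `V_eq_riccatiValue` does not apply. -/
lemma admissible_zero (hT : 0 < D.T) (hQf : D.Qf.PosSemidef) (h : D.Admissible 0) (lam : ℝ) :
    D.Admissible lam := by
  have h1 := admissible_iff.1 h D.T hT le_rfl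
  rw [PenaltyAt, triple_horizon, posDef_penalty_iff (posSemidef_symm hQf)] at h1
  have hw : ∀ w : Fin k → ℝ, w = 0 := fun w => by
    by_contra hw
    have := h1 w hw
    linarith [posSemidef_nonneg hQf (D.Xi *ᵥ w)]
  have : IsEmpty (Fin k) := ⟨fun i => one_ne_zero (congrFun (hw fun _ => 1) i)⟩
  exact fun t _ => Matrix.PosDef.of_dotProduct_mulVec_pos
    (Matrix.ext fun i => isEmptyElim i) fun w hw0 => absurd (hw w) hw0

/-- Monotonicity of admissibility is obtained through the game and not from the recursion: an
admissible `l₀ > 0` has finite value, and a finite value makes all larger parameters admissible. -/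
lemma admissible_of_lamHat_lt (hN : 0 < N) (hT : 0 < D.T) (hQ : D.Q.PosSemidef)
    (hQf : D.Qf.PosSemidef) (hR : D.R.PosDef) (h : D.lamHat < lam) : D.Admissible lam := by
  obtain ⟨l, hl, hV⟩ := exists_V_ne_top hN hQ hQf hR (0 : Fin n → ℝ)
  -- For an empty set `sInf` would be the default `0` and carry no information.
  have hne : {l : ℝ | 0 ≤ l ∧ D.Admissible l}.Nonempty :=
    ⟨l + 1, by linarith, admissible_of_V_ne_top hN hT hQ hQf hR hl (by linarith) hV⟩
  obtain ⟨l₀, ⟨hl₀, hadm⟩, hlt⟩ := exists_lt_of_csInf_lt hne h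
  rcases hl₀.eq_or_lt with rfl | hpos
  · exact admissible_zero hT hQf hadm lam
  · refine admissible_of_V_ne_top hN hT hQ hQf hR hl₀ hlt (x := 0) ?_
    rw [V_eq_riccatiValue hN hQ hQf hR hpos hadm]
    exact EReal.coe_ne_top _

/-- A finite value would make the parameters strictly between `lam` and `λ̂` admissible, against the
infimum. -/
lemma V_eq_top_of_lt_lamHat (hN : 0 < N) (hT : 0 < D.T) (hQ : D.Q.PosSemidef)
    (hQf : D.Qf.PosSemidef) (hR : D.R.PosDef) (x : Fin n → ℝ) (hlam : 0 ≤ lam)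
    (h : lam < D.lamHat) : D.V x lam = ⊤ := by
  by_contra hV
  obtain ⟨l, h1, h2⟩ := exists_between h
  have hadm := admissible_of_V_ne_top hN hT hQ hQf hR hlam h1 hV
  exact absurd (csInf_le (s := {l : ℝ | 0 ≤ l ∧ D.Admissible l}) ⟨0, fun _ h => h.1⟩
    ⟨by linarith, hadm⟩) (not_le.2 h2)

lemma riccatiWellDefined (hN : 0 < N) (hQ : D.Q.PosSemidef) (hQf : D.Qf.PosSemidef)
    (hR : D.R.PosDef) (hlam : 0 < lam) (h : D.Admissible lam) : D.RiccatiWellDefined lam := by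
  intro t ht
  obtain ⟨h1, h2⟩ := Finset.mem_Icc.1 ht
  obtain ⟨s, rfl⟩ : ∃ s, t = s + 1 := ⟨t - 1, by omega⟩
  have hreg := h.isRegular hN hQ hQf hR hlam h2
  have hG := isUnit_one_sub_gain D hlam hreg.penalty
  exact ⟨D.isUnit_one_add_mul_Phi hR hreg.posSemidef hlam hreg.penalty, hG, D.isUnit_one_sub_mul hG⟩

/-! ### Joint convexity. -/

/-- Joint convexity of the value functions in the parameter and the state. -/
lemma quad_triple_convex (hN : 0 < N) (hQ : D.Q.PosSemidef) (hQf : D.Qf.PosSemidef)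
    (hR : D.R.PosDef) {l₁ l₂ a b : ℝ} (hl₁ : 0 < l₁) (hl₂ : 0 < l₂) (ha : 0 ≤ a) (hb : 0 ≤ b)
    (hab : a + b = 1) (hl : 0 < a * l₁ + b * l₂) (h₁ : D.Admissible l₁) (h₂ : D.Admissible l₂)
    (h : D.Admissible (a * l₁ + b * l₂)) {t : ℕ} (ht : t ≤ D.T) :
    ∀ x₁ x₂ : Fin n → ℝ, quad (D.triple (a * l₁ + b * l₂) t) (a • x₁ + b • x₂) ≤
      a * quad (D.triple l₁ t) x₁ + b * quad (D.triple l₂ t) x₂ := by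
  induction ht using Nat.decreasingInduction with
  | self =>
    intro x₁ x₂
    simp only [quad_triple_horizon]
    exact quadForm_convex hQf x₁ x₂ ha hb hab
  | of_succ t ht ih =>
    intro x₁ x₂
    have hr := h.isRegular hN hQ hQf hR hl ht
    have hr₁ := h₁.isRegular hN hQ hQf hR hl₁ ht
    have hr₂ := h₂.isRegular hN hQ hQf hR hl₂ ht
    rw [triple_step ht, triple_step ht, triple_step ht, ← saddle_value hN hR hl hr,
      ← saddle_value hN hR hl₁ hr₁, ← saddle_value hN hR hl₂ hr₂]
    set u₁ := D.saddleControl l₁ t (D.triple l₁ (t + 1)) x₁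
    set u₂ := D.saddleControl l₂ t (D.triple l₂ (t + 1)) x₂
    -- The convex combination of the two saddle controls is played against the saddle shift of the
    -- combined problem. That same shift is at best optimal against each of the two controls in its
    -- own problem, and the penalty splits because it is linear in the parameter.
    refine (saddle_le_stage hN hR hl hr t _ (a • u₁ + b • u₂)).trans ?_
    have hstage : D.stageCost (a • x₁ + b • x₂) (a • u₁ + b • u₂) ≤
        a * D.stageCost x₁ u₁ + b * D.stageCost x₂ u₂ := by
      have e₁ := quadForm_convex hQ x₁ x₂ ha hb hab
      have e₂ := quadForm_convex hR.posSemidef u₁ u₂ ha hb hab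
      simp only [stageCost]
      linarith
    have hpay : ∀ i, quad (D.triple (a * l₁ + b * l₂) (t + 1))
        (D.next (a • x₁ + b • x₂) (a • u₁ + b • u₂) (D.what t i +
          D.saddleShift (a * l₁ + b * l₂) t (D.triple (a * l₁ + b * l₂) (t + 1))
            (a • x₁ + b • x₂) i)) - (a * l₁ + b * l₂) *
          (D.saddleShift (a * l₁ + b * l₂) t (D.triple (a * l₁ + b * l₂) (t + 1))
            (a • x₁ + b • x₂) i ⬝ᵥ
          D.saddleShift (a * l₁ + b * l₂) t (D.triple (a * l₁ + b * l₂) (t + 1))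
            (a • x₁ + b • x₂) i) ≤
        a * D.saddlePayoff l₁ t (D.triple l₁ (t + 1)) x₁ i +
          b * D.saddlePayoff l₂ t (D.triple l₂ (t + 1)) x₂ i := fun i => by
      set d := D.saddleShift (a * l₁ + b * l₂) t (D.triple (a * l₁ + b * l₂) (t + 1))
            (a • x₁ + b • x₂) i
      have e₀ : D.next (a • x₁ + b • x₂) (a • u₁ + b • u₂) (D.what t i + d) =
          a • D.next x₁ u₁ (D.what t i + d) + b • D.next x₂ u₂ (D.what t i + d) := by
        have : D.Xi *ᵥ (D.what t i + d) =
            a • (D.Xi *ᵥ (D.what t i + d)) + b • (D.Xi *ᵥ (D.what t i + d)) := by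
          rw [← add_smul, hab, one_smul]
        rw [next, this]
        simp only [next, Matrix.mulVec_add, Matrix.mulVec_smul, smul_add]
        abel
      have e₁ := mul_le_mul_of_nonneg_left
        (quad_next_le hR hl₁ hr₁ t x₁ i (D.what t i + d)) ha
      have e₂ := mul_le_mul_of_nonneg_left
        (quad_next_le hR hl₂ hr₂ t x₂ i (D.what t i + d)) hb
      rw [add_sub_cancel_left] at e₁ e₂
      have e₃ := ih (D.next x₁ u₁ (D.what t i + d)) (D.next x₂ u₂ (D.what t i + d))
      rw [e₀]
      linarith
    have havg := avg_mono hpay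
    rw [avg_add, avg_const_mul, avg_const_mul] at havg
    change _ ≤ a * avg (D.saddlePayoff l₁ t (D.triple l₁ (t + 1)) x₁) +
      b * avg (D.saddlePayoff l₂ t (D.triple l₂ (t + 1)) x₂) at havg
    linarith

lemma riccatiValue_convex (hN : 0 < N) (hT : 0 < D.T) (hQ : D.Q.PosSemidef)
    (hQf : D.Qf.PosSemidef) (hR : D.R.PosDef) :
    ConvexOn ℝ (Set.Ioi D.lamHat ×ˢ (Set.univ : Set (Fin n → ℝ)))
      (fun p : ℝ × (Fin n → ℝ) => D.riccatiValue p.2 p.1) := by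
  have hconv := (convex_Ioi D.lamHat).prod (convex_univ (𝕜 := ℝ) (E := Fin n → ℝ))
  refine ⟨hconv, ?_⟩
  intro p hp q hq a b ha hb hab
  have hpq := (hconv hp hq ha hb hab).1
  have hadm : ∀ {l}, D.lamHat < l → D.Admissible l := fun h =>
    admissible_of_lamHat_lt hN hT hQ hQf hR h
  have hpos : ∀ {l}, D.lamHat < l → 0 < l := fun h => lamHat_nonneg.trans_lt h
  have h := quad_triple_convex hN hQ hQf hR (hpos hp.1) (hpos hq.1) ha hb hab (hpos hpq)
    (hadm hp.1) (hadm hq.1) (hadm hpq) (Nat.zero_le _) p.2 q.2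
  have h2 := div_le_div_of_nonneg_right h (Nat.cast_nonneg D.T)
  rw [add_div, mul_div_assoc, mul_div_assoc] at h2
  exact h2

end Data

end WassersteinLQ

end

/-! ### Assembly of the main theorem. -/

theorem mainTheorem8 {n m k N : ℕ} (D : WassersteinLQ.Data n m k N)
    (hN : 0 < N) (hT : 0 < D.T)
    (hQ : D.Q.PosSemidef) (hQf : D.Qf.PosSemidef) (hR : D.R.PosDef) (θ : ℝ) :
    -- above the threshold the defining condition holds and the Riccati recursion is well defined
    (∀ lam : ℝ, D.lamHat < lam → D.Admissible lam ∧ D.RiccatiWellDefined lam) ∧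
    -- the value is infinite below the threshold
    (∀ (x : Fin n → ℝ) (lam : ℝ), 0 ≤ lam → lam < D.lamHat → D.V x lam = ⊤) ∧
    -- above it the value is finite and given by the Riccati recursion
    (∀ (x : Fin n → ℝ) (lam : ℝ), D.lamHat < lam → D.V x lam = (D.riccatiValue x lam : EReal)) ∧
    -- a minimizer of the reduced problem is a minimizer over all nonnegative parameters
    (∀ (x : Fin n → ℝ) (lamStar : ℝ), lamStar ∈ Set.Ioi D.lamHat →
      IsMinOn (fun lam : ℝ => lam * θ ^ 2 + D.riccatiValue x lam) (Set.Ioi D.lamHat) lamStar →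
      lamStar ∈ Set.Ici (0 : ℝ) ∧
        IsMinOn (fun lam : ℝ => ((lam * θ ^ 2 : ℝ) : EReal) + D.V x lam)
          (Set.Ici (0 : ℝ)) lamStar) ∧
    -- the reduced problem is convex
    (∀ x : Fin n → ℝ,
      ConvexOn ℝ (Set.Ioi D.lamHat) (fun lam : ℝ => lam * θ ^ 2 + D.riccatiValue x lam)) ∧
    -- the value is jointly convex
    ConvexOn ℝ (Set.Ioi D.lamHat ×ˢ (Set.univ : Set (Fin n → ℝ)))
      (fun p : ℝ × (Fin n → ℝ) => (D.V p.2 p.1).toReal) := by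
  have hadm : ∀ lam : ℝ, D.lamHat < lam → D.Admissible lam := fun lam h =>
    WassersteinLQ.Data.admissible_of_lamHat_lt hN hT hQ hQf hR h
  have hpos : ∀ lam : ℝ, D.lamHat < lam → 0 < lam := fun lam h =>
    WassersteinLQ.Data.lamHat_nonneg.trans_lt h
  have htop : ∀ (x : Fin n → ℝ) (lam : ℝ), 0 ≤ lam → lam < D.lamHat → D.V x lam = ⊤ :=
    fun x lam h0 h => WassersteinLQ.Data.V_eq_top_of_lt_lamHat hN hT hQ hQf hR x h0 h
  have hval : ∀ (x : Fin n → ℝ) (lam : ℝ), D.lamHat < lam →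
      D.V x lam = (D.riccatiValue x lam : EReal) := fun x lam h =>
    WassersteinLQ.Data.V_eq_riccatiValue hN hQ hQf hR (hpos lam h) (hadm lam h) x
  have hconv := WassersteinLQ.Data.riccatiValue_convex hN hT hQ hQf hR
  refine ⟨fun lam h => ⟨hadm lam h, WassersteinLQ.Data.riccatiWellDefined hN hQ hQf hR
    (hpos lam h) (hadm lam h)⟩, htop, hval, fun x l hl hmin => ?_, fun x => ?_, ?_⟩
  · refine ⟨(hpos l hl).le, fun lam hlam => ?_⟩
    change ((l * θ ^ 2 : ℝ) : EReal) + D.V x l ≤ ((lam * θ ^ 2 : ℝ) : EReal) + D.V x lam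
    have hmin' : ∀ lam, D.lamHat < lam →
        l * θ ^ 2 + D.riccatiValue x l ≤ lam * θ ^ 2 + D.riccatiValue x lam := fun lam h => hmin h
    rw [hval x l hl]
    rcases lt_trichotomy lam D.lamHat with h | h | h
    · rw [htop x lam hlam h, EReal.coe_add_top]
      exact le_top
    -- The value at the threshold itself is not identified. It is at least the value at every larger
    -- parameter, so the comparison is made from the right.
    · induction hv : D.V x lam with
      | bot =>
        have h1 := WassersteinLQ.Data.V_antitone (D := D) x (h ▸ (Set.mem_Ioi.1 hl).le : lam ≤ l)
        rw [hval x l hl, hv] at h1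
        exact absurd (le_bot_iff.1 h1) (EReal.coe_ne_bot _)
      | top => rw [EReal.coe_add_top]; exact le_top
      | coe v =>
        rw [← EReal.coe_add, ← EReal.coe_add, EReal.coe_le_coe_iff]
        refine le_of_forall_pos_le_add fun ε hε => ?_
        -- Moving right by `s` raises the linear term by `sθ² ≤ ε`; the `+ 1` covers `θ = 0`.
        set s := ε / (θ ^ 2 + 1) with hs
        have hs0 : 0 < s := by positivity
        have h1 := hmin' (lam + s) (by linarith)
        have h2 := WassersteinLQ.Data.V_antitone (D := D) x (by linarith : lam ≤ lam + s)
        rw [hval x (lam + s) (by linarith), hv, EReal.coe_le_coe_iff] at h2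
        have h3 : s * (θ ^ 2 + 1) = ε := div_mul_cancel₀ _ (by positivity)
        linarith
    · rw [hval x lam h, ← EReal.coe_add, ← EReal.coe_add, EReal.coe_le_coe_iff]
      exact hmin' lam h
  · refine ⟨convex_Ioi _, fun p hp q hq a b ha hb hab => ?_⟩
    have h := hconv.2 (x := (p, x)) ⟨hp, trivial⟩ (y := (q, x)) ⟨hq, trivial⟩ ha hb hab
    have hx : a • x + b • x = x := by rw [← add_smul, hab, one_smul]
    simp only [Prod.smul_mk, Prod.mk_add_mk, hx, smul_eq_mul] at h ⊢
    linarith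
  · refine hconv.congr fun p hp => ?_
    rw [hval p.2 p.1 hp.1, EReal.toReal_coe]
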